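/- For a positive integer $n$ let $K_n^*$ denote the complete graph $K_n$ if $n$ is odd, and $K_n$ minus the edges of a $1$-factor if $n$ is even. A $2$-factor on $n$ vertices is a $2$-regular graph on $n$ vertices. Let $v>m$ be positive integers with $v\equiv m\equiv 2\pmod 4$. Let $\mathcal F=\{F_i : 1\le i\le (v-m)/2\}$, $\mathcal T=\{T_j : 1\le j\le (m-2)/2\}$ and $\mathcal U=\{U_j : 1\le j\le (m-2)/2\}$ be families of bipartite $2$-factors on $v$, $m$ and $v-m$ vertices respectively, such that $F_i\cong F_{i+1}$, $T_j\cong T_{j+1}$ and $U_j\cong U_{j+1}$ for all odd $i$ and $j$. A minisymposium factorization $\mathrm{MSF}(\mathcal F,(\mathcal T,\mathcal U))$ is a decomposition of the edges of $K_v^*=K_v-I$, $I$ a $1$-factor of $K_v$, into spanning subgraphs $F_i'$ $(1\le i\le (v-m)/2)$ and $T_j'\cup U_j'$ $(1\le j\le (m-2)/2)$, together with a set $M$ of $m$ vertices, such that $F_i'\cong F_i$; $T_j'$ is a graph with vertex set $M$ and $T_j'\cong T_j$; $U_j'$ is a graph whose vertex set is the complement of $M$ and $U_j'\cong U_j$;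 and the graphs $T_j'$ decompose the edges of a copy of $K_m^*$ with vertex set $M$, namely the complete graph on $M$ minus the edges of a $1$-factor $J$ of it with $J\subseteq I$. Then an $\mathrm{MSF}(\mathcal F,(\mathcal T,\mathcal U))$ exists if and only if $v\ge 2m$. -/

import Mathlib

namespace Minisymposium

/-- `G` is an `r`-factor on its vertex type: every vertex has exactly `r` neighbours. -/
def IsFactor {V : Type*} (r : ℕ) (G : SimpleGraph V) : Prop :=
  ∀ x, (G.neighborSet x).ncard = r

/-- `K` is a copy of `Kₙ*` on the finite vertex type `V`, where `n = |V|`: the complete graph if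
`n` is odd, and the complete graph minus the edges of a 1-factor `I` if `n` is even. -/
def IsCompleteStar {V : Type*} (K : SimpleGraph V) : Prop :=
  (Odd (Nat.card V) ∧ K = ⊤) ∨
    (Even (Nat.card V) ∧ ∃ I : SimpleGraph V, IsFactor 1 I ∧ K = ⊤ \ I)

/-- The spanning subgraphs `A i` decompose the edges of `K`: they are pairwise edge-disjoint and
their union is `K`. -/
def IsFactorization {V ι : Type*} (A : ι → SimpleGraph V) (K : SimpleGraph V) : Prop :=
  Pairwise (fun i j => Disjoint (A i) (A j)) ∧ (⨆ i, A i) = K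

/-- A minisymposium factorization `MSF(F, (T, U))`, for prescribed 2-factors `F i` on `v` vertices,
`T j` on `m` vertices and `U j` on `v - m` vertices.  For 2-factors the numbers `f` and `t` of
prescribed factors are forced by counting: `t = ⌊(m-1)/2⌋` and `f = ⌊(v-1)/2⌋ - ⌊(m-1)/2⌋`
whenever `1 ≤ m ≤ v`. -/
structure MSF {v m f t : ℕ} (F : Fin f → SimpleGraph (Fin v))
    (T : Fin t → SimpleGraph (Fin m)) (U : Fin t → SimpleGraph (Fin (v - m))) where
  /-- the graph `K_v*` that is factored -/
  K : SimpleGraph (Fin v)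
  isCompleteStar_K : IsCompleteStar K
  /-- the vertex set of the subsystem -/
  M : Set (Fin v)
  ncard_M : M.ncard = m
  /-- the copy of `K_m*` on the vertex set `M` -/
  H : SimpleGraph M
  isCompleteStar_H : IsCompleteStar H
  H_le_K : H.spanningCoe ≤ K
  /-- If `v` is even, the 1-factor missing from `K_m*` (if any) lies in the one missing
  from `K_v*`. -/
  leave_le : Even v → Hᶜ.spanningCoe ≤ Kᶜ
  /-- the copies of the prescribed factors `F i` -/
  A : Fin f → SimpleGraph (Fin v)
  /-- the copies of the prescribed factors `T j`, on the vertices in `M` -/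
  B : Fin t → SimpleGraph M
  /-- the copies of the prescribed factors `U j`, on the vertices outside `M` -/
  C : Fin t → SimpleGraph (Mᶜ : Set (Fin v))
  iso_F : ∀ i, Nonempty (A i ≃g F i)
  iso_T : ∀ j, Nonempty (B j ≃g T j)
  iso_U : ∀ j, Nonempty (C j ≃g U j)
  /-- The copies of the `F i`, with the unions of the copies of `T j` and `U j`, factor `K_v*`. -/
  factorization_K :
    IsFactorization (Sum.elim A (fun j => (B j).spanningCoe ⊔ (C j).spanningCoe)) K
  /-- The copies of the `T j` factor `K_m*`. -/
  factorization_H : IsFactorization B H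

/-- The members of the family come in consecutive pairs of equal (that is, isomorphic) graphs:
the first and second, the third and fourth, and so on (so the smaller 0-based index is even). -/
def EqualPairs {V : Type*} {k : ℕ} (A : Fin k → SimpleGraph V) : Prop :=
  ∀ i j : Fin k, Even i.val → j.val = i.val + 1 → Nonempty (A i ≃g A j)

end Minisymposium

/-! Necessity: an edge inside `M` lies in some `T_j` or in `J`, so a factor `F_i` has no edge inside
`M`. Its edges join each vertex of `M` to two vertices outside, each of which receives at most two,
whence `m ≤ v - m`.

Sufficiency: put `m = 2n` and `v = 2(n + w)`, so that `n` is odd, `w` is even and `n ≤ w`. Replacing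
each vertex of `K_{n+w}` by two nonadjacent copies gives `K_v` minus a 1-factor, and a doubled
`N`-cycle splits into two copies of any bipartite 2-factor on `2N` vertices (Häggkvist's argument,
`exists_two_copies`). This is why the factors come in equal pairs. It remains to decompose `K_{n+w}`
into `(n-1)/2` Hamilton cycles of an `n`-set, as many of its complement, and `w/2` Hamilton cycles
of the whole (`exists_hamilton_decomposition`).

That decomposition comes from Hilton's method of amalgamations. Merging each of the two sets into
one vertex leaves a two-vertex multigraph whose colour multiplicities are easily written down
(`isAmalgam_part`). Vertices are then split off one at a time (`IsAmalgam.exists_split`): each new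
vertex takes a fair share of the edges, rounded to integers by a flow argument
(`exists_integral_table`) so that every colour class stays connected and keeps degree two per
vertex. -/

namespace Minisymposium

/-! ### Rounding of circulations and tables. -/

section Circulation

variable {N E : Type*} [Fintype E] [DecidableEq N]

/-- The net outflow of `f` at the node `v`. -/
def netOutflow {R : Type*} [AddCommGroup R] (src tgt : E → N) (f : E → R) (v : N) : R :=
  ∑ e with src e = v, f e - ∑ e with tgt e = v, f e

theorem netOutflow_add {R : Type*} [AddCommGroup R] (src tgt : E → N) (f g : E → R) (v : N) :
    netOutflow src tgt (f + g) v = netOutflow src tgt f v + netOutflow src tgt g v := by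
  simp only [netOutflow, Pi.add_apply, Finset.sum_add_distrib]
  abel

theorem netOutflow_smul (src tgt : E → N) (t : ℝ) (g : E → ℝ) (v : N) :
    netOutflow src tgt (t • g) v = t * netOutflow src tgt g v := by
  simp only [netOutflow, Pi.smul_apply, smul_eq_mul, ← Finset.mul_sum]
  ring

theorem netOutflow_intCast (src tgt : E → N) (g : E → ℤ) (v : N) :
    netOutflow src tgt (fun e => (g e : ℝ)) v = ((netOutflow src tgt g v : ℤ) : ℝ) := by
  simp [netOutflow]

theorem sum_netOutflow [Fintype N] (src tgt : E → N) (f : E → ℝ) :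
    ∑ v, netOutflow src tgt f v = 0 := by
  simp only [netOutflow, Finset.sum_sub_distrib]
  rw [Finset.sum_fiberwise, Finset.sum_fiberwise, sub_self]

open Classical in
/-- A node of a circulation that meets a fractional edge meets at least two of them. -/
theorem two_le_card_fractional (src tgt : E → N) (f : E → ℝ) (v : N)
    (hf : netOutflow src tgt f v = 0)
    (h : ∃ e, Int.fract (f e) ≠ 0 ∧ (src e = v ∨ tgt e = v)) :
    2 ≤ (Finset.univ.filter fun e => Int.fract (f e) ≠ 0 ∧ src e = v).card
      + (Finset.univ.filter fun e => Int.fract (f e) ≠ 0 ∧ tgt e = v).card := by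
  -- The integer parts contribute an integer to the outflow, so the fractional parts do too; a
  -- single fractional part, strictly between 0 and 1, cannot.
  have key : ((netOutflow src tgt (fun e => ⌊f e⌋) v : ℤ) : ℝ)
      + netOutflow src tgt (fun e => Int.fract (f e)) v = 0 := by
    rw [← netOutflow_intCast, ← netOutflow_add, ← hf]
    congr 1
    ext e
    simp [Int.floor_add_fract]
  have hs : ∀ s : E → N, ∑ e with s e = v, Int.fract (f e)
      = ∑ e with (Int.fract (f e) ≠ 0 ∧ s e = v), Int.fract (f e) := by
    intro s
    symm
    apply Finset.sum_subset
    · intro e he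
      simp only [Finset.mem_filter, Finset.mem_univ, true_and] at he ⊢
      exact he.2
    · intro e he he'
      simp only [Finset.mem_filter, Finset.mem_univ, true_and] at he he'
      by_contra h0
      exact he' ⟨h0, he⟩
  rw [netOutflow.eq_def _ _ (fun e => Int.fract (f e)), hs src, hs tgt] at key
  by_contra hlt
  set P := Finset.univ.filter fun e => Int.fract (f e) ≠ 0 ∧ src e = v with hP
  set Q := Finset.univ.filter fun e => Int.fract (f e) ≠ 0 ∧ tgt e = v with hQ
  have contra : ∀ (e : E) (z : ℤ), Int.fract (f e) ≠ 0 → Int.fract (f e) = z → False := by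
    intro e z h0 hz
    have h1 := Int.fract_lt_one (f e)
    have h2 := lt_of_le_of_ne (Int.fract_nonneg (f e)) (Ne.symm h0)
    rw [hz] at h1 h2
    have h1' : z < 1 := by exact_mod_cast h1
    have h2' : 0 < z := by exact_mod_cast h2
    omega
  obtain ⟨e, he, hv⟩ := h
  have hPQ : (P.card = 1 ∧ Q.card = 0) ∨ (P.card = 0 ∧ Q.card = 1) := by
    have : 0 < P.card + Q.card := by
      rcases hv with hv | hv
      · have : e ∈ P := by simp [hP, he, hv]
        have := Finset.card_pos.2 ⟨e, this⟩
        omega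
      · have : e ∈ Q := by simp [hQ, he, hv]
        have := Finset.card_pos.2 ⟨e, this⟩
        omega
    omega
  rcases hPQ with ⟨h1, h0⟩ | ⟨h0, h1⟩
  · obtain ⟨a, ha⟩ := Finset.card_eq_one.1 h1
    have haP : a ∈ P := by simp [ha]
    rw [Finset.card_eq_zero.1 h0, ha] at key
    simp only [Finset.sum_singleton, Finset.sum_empty, sub_zero] at key
    refine contra a (-(netOutflow src tgt (fun e => ⌊f e⌋) v)) (by simp [hP] at haP; exact fun h => haP.1 (by simpa using h)) ?_
    push_cast
    linarith
  · obtain ⟨a, ha⟩ := Finset.card_eq_one.1 h1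
    have haQ : a ∈ Q := by simp [ha]
    rw [Finset.card_eq_zero.1 h0, ha] at key
    simp only [Finset.sum_singleton, Finset.sum_empty, zero_sub] at key
    refine contra a (netOutflow src tgt (fun e => ⌊f e⌋) v) (by simp [hQ] at haQ; exact fun h => haQ.1 (by simpa using h)) ?_
    linarith

open Classical in
/-- A circulation with a fractional edge can be perturbed along its fractional edges. -/
theorem exists_fractional_circulation [Fintype N] (src tgt : E → N) (f : E → ℝ)
    (hf : ∀ v, netOutflow src tgt f v = 0) (h : ∃ e, Int.fract (f e) ≠ 0) :
    ∃ d : E → ℝ, d ≠ 0 ∧ (∀ v, netOutflow src tgt d v = 0) ∧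
      ∀ e, Int.fract (f e) = 0 → d e = 0 := by
  set X : Finset E := Finset.univ.filter fun e => Int.fract (f e) ≠ 0 with hX
  set Y : Finset N := X.image src ∪ X.image tgt with hY
  obtain ⟨e0, he0⟩ := h
  have he0X : e0 ∈ X := by simpa [hX] using he0
  have hv0 : src e0 ∈ Y := Finset.mem_union_left _ (Finset.mem_image_of_mem _ he0X)
  -- A fractional edge has two ends and every node of `Y` is an end at least twice, so `2|Y| ≤
  -- 2|X|`.
  have hcard : Y.card ≤ X.card := by
    have h1 : ∑ v ∈ Y, 2 ≤ ∑ v ∈ Y, ((X.filter fun e => src e = v).card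
        + (X.filter fun e => tgt e = v).card) := by
      refine Finset.sum_le_sum fun v hv => ?_
      have := two_le_card_fractional src tgt f v (hf v) (by
        simp only [hY, Finset.mem_union, Finset.mem_image, hX, Finset.mem_filter] at hv
        rcases hv with ⟨e, he, rfl⟩ | ⟨e, he, rfl⟩
        · exact ⟨e, he.2, Or.inl rfl⟩
        · exact ⟨e, he.2, Or.inr rfl⟩)
      simpa only [hX, Finset.filter_filter] using this
    rw [Finset.sum_add_distrib, ← Finset.card_eq_sum_card_fiberwise, ←
      Finset.card_eq_sum_card_fiberwise] at h1
    · simp at h1; omega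
    · intro e he; exact Finset.mem_union_right _ (Finset.mem_image_of_mem _ he)
    · intro e he; exact Finset.mem_union_left _ (Finset.mem_image_of_mem _ he)
  let ext : (X → ℝ) →ₗ[ℝ] (E → ℝ) :=
    { toFun := fun d e => if he : e ∈ X then d ⟨e, he⟩ else 0
      map_add' := by intro a b; ext e; by_cases he : e ∈ X <;> simp [he]
      map_smul' := by intro a b; ext e; by_cases he : e ∈ X <;> simp [he] }
  -- Conservation is imposed at all nodes of `Y` but one, giving fewer equations than unknowns; it
  -- holds at the omitted node because all outflows sum to zero.
  let Φ : (X → ℝ) →ₗ[ℝ] ((Y.erase (src e0) : Finset N) → ℝ) :=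
    { toFun := fun d v => netOutflow src tgt (ext d) v
      map_add' := by intro a b; ext v; simp [netOutflow_add]
      map_smul' := by intro a b; ext v; simp [netOutflow_smul] }
  have hker : LinearMap.ker Φ ≠ ⊥ := by
    apply LinearMap.ker_ne_bot_of_finrank_lt
    simp only [Module.finrank_fintype_fun_eq_card, Fintype.card_coe, Finset.card_erase_of_mem hv0]
    have := Finset.card_pos.2 ⟨_, hv0⟩
    omega
  obtain ⟨d, hd, hd0⟩ := (Submodule.ne_bot_iff _).1 hker
  have hout : ∀ v, v ∉ Y → netOutflow src tgt (ext d) v = 0 := by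
    intro v hv
    have : ∀ e, (src e = v ∨ tgt e = v) → ext d e = 0 := by
      intro e he
      have : e ∉ X := by
        intro heX
        apply hv
        rcases he with rfl | rfl
        · exact Finset.mem_union_left _ (Finset.mem_image_of_mem _ heX)
        · exact Finset.mem_union_right _ (Finset.mem_image_of_mem _ heX)
      simp [ext, this]
    rw [netOutflow, Finset.sum_eq_zero, Finset.sum_eq_zero, sub_zero]
    · intro e he; exact this e (Or.inr (by simpa using he))
    · intro e he; exact this e (Or.inl (by simpa using he))
  have hne : ∀ v, v ≠ src e0 → netOutflow src tgt (ext d) v = 0 := by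
    intro v hv
    by_cases hvY : v ∈ Y
    · exact congrFun (LinearMap.mem_ker.1 hd) ⟨v, Finset.mem_erase.2 ⟨hv, hvY⟩⟩
    · exact hout v hvY
  refine ⟨ext d, ?_, ?_, ?_⟩
  · intro h0
    apply hd0
    ext ⟨e, he⟩
    have := congrFun h0 e
    simpa [ext, he] using this
  · intro v
    by_cases hv : v = src e0
    · have := sum_netOutflow src tgt (ext d)
      rw [Finset.sum_eq_single (src e0) (fun v _ hv => hne v hv) (by simp)] at this
      rw [hv, this]
    · exact hne v hv
  · intro e he
    have : e ∉ X := by simp [hX, he]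
    simp [ext, this]

/-- A real circulation can be rounded to an integral one. -/
theorem exists_integral_circulation [Fintype N] (src tgt : E → N) (f : E → ℝ)
    (hf : ∀ v, netOutflow src tgt f v = 0) :
    ∃ g : E → ℤ, (∀ v, netOutflow src tgt g v = 0) ∧ ∀ e, ⌊f e⌋ ≤ g e ∧ g e ≤ ⌈f e⌉ := by
  classical
  induction hk : (Finset.univ.filter fun e => Int.fract (f e) ≠ 0).card using Nat.strong_induction_on
    generalizing f with
  | _ k ih =>
  by_cases hfrac : ∃ e, Int.fract (f e) ≠ 0
  · obtain ⟨d, hd0, hd, hdz⟩ := exists_fractional_circulation src tgt f hf hfrac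
    -- `r e` is how far `f` can move along `d` before edge `e` reaches its ceiling or floor. The
    -- least such step keeps every edge within its bounds and makes one more edge integral.
    let r : E → ℝ := fun e =>
      if 0 < d e then (⌈f e⌉ - f e) / d e else (f e - ⌊f e⌋) / (-d e)
    have hne : (Finset.univ.filter fun e => d e ≠ 0).Nonempty := by
      obtain ⟨e, he⟩ := Function.ne_iff.1 hd0
      exact ⟨e, by simpa using he⟩
    obtain ⟨a, ha, hmin⟩ := Finset.exists_min_image _ r hne
    have ha' : d a ≠ 0 := by simpa using ha
    have hr0 : 0 ≤ r a := by
      simp only [r]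
      split_ifs with h
      · exact div_nonneg (sub_nonneg.2 (Int.le_ceil _)) h.le
      · exact div_nonneg (sub_nonneg.2 (Int.floor_le _)) (by linarith)
    have hb : ∀ e, (⌊f e⌋ : ℝ) ≤ f e + r a * d e ∧ f e + r a * d e ≤ ⌈f e⌉ := by
      intro e
      have hfl := Int.floor_le (f e)
      have hce := Int.le_ceil (f e)
      rcases lt_trichotomy (d e) 0 with h | h | h
      · have h1 := hmin e (by simp [h.ne])
        have h2 : r e = (f e - ⌊f e⌋) / (-d e) := by simp [r, not_lt.2 h.le]
        rw [h2, le_div_iff₀ (by linarith)] at h1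
        constructor
        · linarith
        · nlinarith
      · simp [h, hfl, hce]
      · have h1 := hmin e (by simp [h.ne'])
        have h2 : r e = (⌈f e⌉ - f e) / d e := by simp [r, h]
        rw [h2, le_div_iff₀ h] at h1
        constructor
        · nlinarith
        · linarith
    have hint : Int.fract (f a + r a * d a) = 0 := by
      by_cases h : 0 < d a
      · have : f a + r a * d a = ⌈f a⌉ := by
          simp only [r, h, if_true]
          field_simp
          ring
        rw [this, Int.fract_intCast]
      · have : f a + r a * d a = ⌊f a⌋ := by
          simp only [r, h, if_false]
          field_simp
          ring
        rw [this, Int.fract_intCast]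
    obtain ⟨g, hg, hgb⟩ := ih _ (by
      rw [← hk]
      refine Finset.card_lt_card (Finset.ssubset_iff_of_subset ?_ |>.2 ⟨a, ?_, ?_⟩)
      · intro e he
        simp only [Finset.mem_filter, Finset.mem_univ, true_and] at he ⊢
        intro h0
        apply he
        rw [Pi.add_apply, Pi.smul_apply, hdz e h0, smul_zero, add_zero, h0]
      · simp only [Finset.mem_filter, Finset.mem_univ, true_and]
        exact fun h0 => ha' (hdz a h0)
      · simp only [Finset.mem_filter, Finset.mem_univ, true_and, not_not]
        simpa using hint) (f + r a • d) (by
          intro v; rw [netOutflow_add, netOutflow_smul, hf, hd]; simp) rfl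
    refine ⟨g, hg, fun e => ⟨?_, ?_⟩⟩
    · refine le_trans ?_ (hgb e).1
      rw [Int.le_floor]
      exact (hb e).1
    · refine le_trans (hgb e).2 ?_
      rw [Int.ceil_le]
      exact (hb e).2
  · push Not at hfrac
    have hfl : ∀ e, ((⌊f e⌋ : ℤ) : ℝ) = f e := by
      intro e
      have := Int.floor_add_fract (f e)
      rw [hfrac e] at this
      linarith
    refine ⟨fun e => ⌊f e⌋, fun v => ?_, fun e => ⟨le_rfl, Int.floor_le_ceil _⟩⟩
    have := netOutflow_intCast src tgt (fun e => ⌊f e⌋) v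
    simp only [hfl] at this
    rw [hf v] at this
    exact_mod_cast this.symm

end Circulation

/-- A real table with integral row and column sums can be rounded to an integral one with the
same row and column sums, rounding also the sums over the blocks of a partition of each row. -/
theorem exists_integral_table {C V κ : Type*} [Fintype C] [Fintype V] [Fintype κ] [DecidableEq κ]
    (block : C → V → κ) (f : C → V → ℝ) (r : C → ℤ) (q : V → ℤ)
    (hr : ∀ c, ∑ y, f c y = r c) (hq : ∀ y, ∑ c, f c y = q y) :
    ∃ g : C → V → ℤ, (∀ c, ∑ y, g c y = r c) ∧ (∀ y, ∑ c, g c y = q y) ∧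
      (∀ c y, ⌊f c y⌋ ≤ g c y ∧ g c y ≤ ⌈f c y⌉) ∧
      (∀ c k, ∑ y with block c y = k, g c y ≤ ⌈∑ y with block c y = k, f c y⌉) := by
  classical
  -- The network runs from a hub to the rows, from each row to its blocks, from each block to the
  -- columns in it, and back to the hub. Row and column sums sit on the edges at the hub, which are
  -- already integral.
  let src : C ⊕ (C × κ) ⊕ (C × V) ⊕ V → Unit ⊕ C ⊕ (C × κ) ⊕ V :=
    Sum.elim (fun _ => .inl ()) (Sum.elim (fun p => .inr (.inl p.1))
      (Sum.elim (fun p => .inr (.inr (.inl (p.1, block p.1 p.2)))) (fun y => .inr (.inr (.inr y)))))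
  let tgt : C ⊕ (C × κ) ⊕ (C × V) ⊕ V → Unit ⊕ C ⊕ (C × κ) ⊕ V :=
    Sum.elim (fun c => .inr (.inl c)) (Sum.elim (fun p => .inr (.inr (.inl p)))
      (Sum.elim (fun p => .inr (.inr (.inr p.2))) (fun _ => .inl ())))
  let F : C ⊕ (C × κ) ⊕ (C × V) ⊕ V → ℝ :=
    Sum.elim (fun c => r c) (Sum.elim (fun p => ∑ y with block p.1 y = p.2, f p.1 y)
      (Sum.elim (fun p => f p.1 p.2) (fun y => q y)))
  have net : ∀ {R : Type} [AddCommGroup R] (g : C ⊕ (C × κ) ⊕ (C × V) ⊕ V → R),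
      (netOutflow src tgt g (.inl ()) = ∑ c, g (.inl c) - ∑ y, g (.inr (.inr (.inr y)))) ∧
      (∀ c, netOutflow src tgt g (.inr (.inl c)) = ∑ k, g (.inr (.inl (c, k))) - g (.inl c)) ∧
      (∀ c k, netOutflow src tgt g (.inr (.inr (.inl (c, k)))) =
        ∑ y with block c y = k, g (.inr (.inr (.inl (c, y)))) - g (.inr (.inl (c, k)))) ∧
      (∀ y, netOutflow src tgt g (.inr (.inr (.inr y))) =
        g (.inr (.inr (.inr y))) - ∑ c, g (.inr (.inr (.inl (c, y))))) := by
    intro R _ g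
    refine ⟨?_, fun c => ?_, fun c k => ?_, fun y => ?_⟩ <;>
    simp [netOutflow, src, tgt, Finset.sum_filter, Fintype.sum_sum_type, Fintype.sum_prod_type,
      ite_and, Finset.sum_ite_irrel]
    rw [Finset.sum_comm]
    simp
  obtain ⟨n1, n2, n3, n4⟩ := net F
  obtain ⟨G, hG, hb⟩ := exists_integral_circulation src tgt F (by
    rintro (_ | c | ⟨c, k⟩ | y)
    · rw [n1]
      simp only [F, Sum.elim_inl, Sum.elim_inr, ← hr, ← hq]
      rw [Finset.sum_comm, sub_self]
    · rw [n2]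
      simp only [F, Sum.elim_inl, Sum.elim_inr, ← hr]
      rw [Finset.sum_fiberwise, sub_self]
    · rw [n3]
      simp only [F, Sum.elim_inl, Sum.elim_inr, sub_self]
    · rw [n4]
      simp only [F, Sum.elim_inl, Sum.elim_inr, ← hq, sub_self])
  obtain ⟨-, m2, m3, m4⟩ := net G
  have e2 : ∀ c, ∑ k, G (.inr (.inl (c, k))) = G (.inl c) := fun c => by
    have := m2 c; rw [hG] at this; linarith
  have e3 : ∀ c k, ∑ y with block c y = k, G (.inr (.inr (.inl (c, y)))) = G (.inr (.inl (c, k))) :=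
    fun c k => by have := m3 c k; rw [hG] at this; linarith
  have e4 : ∀ y, ∑ c, G (.inr (.inr (.inl (c, y)))) = G (.inr (.inr (.inr y))) := fun y => by
    have := m4 y; rw [hG] at this; linarith
  refine ⟨fun c y => G (.inr (.inr (.inl (c, y)))), fun c => ?_, fun y => ?_,
    fun c y => hb (.inr (.inr (.inl (c, y)))), fun c k => ?_⟩
  · rw [← Finset.sum_fiberwise _ (block c)]
    simp only [e3, e2]
    have := hb (.inl c)
    simp only [F, Sum.elim_inl, Int.floor_intCast, Int.ceil_intCast] at this
    omega
  · rw [e4]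
    have := hb (.inr (.inr (.inr y)))
    simp only [F, Sum.elim_inr, Int.floor_intCast, Int.ceil_intCast] at this
    omega
  · rw [e3]
    exact (hb (.inr (.inl (c, k)))).2

/-! ### Amalgams of complete graphs and their detachment. -/

/-- The graph underlying the multigraph with edge multiplicities `μ`, loops being ignored. -/
def multiplicityGraph {V : Type*} (μ : V → V → ℕ) : SimpleGraph V :=
  SimpleGraph.fromRel fun x y => μ x y ≠ 0

/-- The multigraphs with multiplicities `μ c` (where `μ c x x` is twice the number of loops at `x`)
look like what is left of a decomposition of a complete graph into connected 2-regular graphs when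
the vertices are merged into groups of `b x` vertices; the colour `c` covers the groups `x` with
`act c x`. -/
structure IsAmalgam {C V : Type*} [Fintype C] [Fintype V] (b : V → ℕ) (μ : C → V → V → ℕ)
    (act : C → V → Prop) : Prop where
  pos : ∀ x, 1 ≤ b x
  symm : ∀ c x y, μ c x y = μ c y x
  even_diag : ∀ c x, Even (μ c x x)
  sum_off : ∀ x y, x ≠ y → ∑ c, μ c x y = b x * b y
  sum_diag : ∀ x, ∑ c, μ c x x = b x * (b x - 1)
  deg_act : ∀ c x, act c x → ∑ y, μ c x y = 2 * b x
  deg_not_act : ∀ c x, ¬ act c x → ∑ y, μ c x y = 0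
  conn : ∀ c x y, act c x → act c y → (multiplicityGraph (μ c)).Reachable x y

theorem even_sum_of_symm {V : Type*} (μ : V → V → ℕ) (hs : ∀ x y, μ x y = μ y x)
    (hd : ∀ x, Even (μ x x)) (K : Finset V) : Even (∑ z ∈ K, ∑ w ∈ K, μ z w) := by
  classical
  induction K using Finset.induction_on with
  | empty => simp
  | insert a K ha ih =>
    simp only [Finset.sum_insert ha, Finset.sum_add_distrib]
    have : ∑ z ∈ K, μ z a = ∑ z ∈ K, μ a z := Finset.sum_congr rfl fun z _ => hs z a
    rw [this]
    have h2 : μ a a + ∑ z ∈ K, μ a z + (∑ z ∈ K, μ a z + ∑ z ∈ K, ∑ w ∈ K, μ z w)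
      = μ a a + 2 * ∑ z ∈ K, μ a z + ∑ z ∈ K, ∑ w ∈ K, μ z w := by ring
    rw [h2]
    exact ((hd a).add (even_two_mul _)).add ih

/-- Handshaking: the degrees over `K` have an even sum, edges inside `K` count twice in it, and all
other edges at `K` go to `x`. -/
theorem even_cut {V : Type*} [Fintype V] (μ : V → V → ℕ) (hs : ∀ x y, μ x y = μ y x)
    (hd : ∀ x, Even (μ x x)) (hdeg : ∀ x, Even (∑ y, μ x y)) (x : V) (K : Finset V) (hx : x ∉ K)
    (hK : ∀ z ∈ K, ∀ w ∉ K, w ≠ x → μ z w = 0) : Even (∑ z ∈ K, μ x z) := by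
  classical
  have h1 : ∀ z ∈ K, ∑ w, μ z w = ∑ w ∈ K, μ z w + μ x z := by
    intro z hz
    rw [← Finset.sum_add_sum_compl K, hs x z]
    congr 1
    refine Finset.sum_eq_single x (fun w hw hwx => hK z hz w (by simpa using hw) hwx) ?_
    simp [hx]
  have h2 : Even (∑ z ∈ K, ∑ w, μ z w) := Finset.even_sum _ fun z _ => hdeg z
  rw [Finset.sum_congr rfl h1, Finset.sum_add_distrib] at h2
  exact (Nat.even_add.1 h2).1 (even_sum_of_symm μ hs hd K)

/-- The graph `G` with all edges at the vertex `x` deleted. -/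
def isolate {V : Type*} (G : SimpleGraph V) (x : V) : SimpleGraph V where
  Adj y z := G.Adj y z ∧ y ≠ x ∧ z ≠ x
  symm := ⟨fun _ _ h => ⟨h.1.symm, h.2.2, h.2.1⟩⟩
  loopless := ⟨fun _ h => h.1.ne rfl⟩

theorem reachable_isolate_ne {V : Type*} {G : SimpleGraph V} {x y z : V}
    (h : (isolate G x).Reachable y z) (hy : y ≠ x) : z ≠ x := by
  obtain ⟨p⟩ := h
  induction p with
  | nil => exact hy
  | cons h _ ih => exact ih h.2.2

/-- Cut a walk to `x` just before its first visit there. -/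
theorem exists_reachable_isolate {V : Type*} {G : SimpleGraph V} {x y : V} (h : G.Reachable y x)
    (hy : y ≠ x) : ∃ z, (isolate G x).Reachable y z ∧ G.Adj z x := by
  obtain ⟨p⟩ := h
  induction p with
  | nil => exact absurd rfl hy
  | @cons u v w h _ ih =>
    by_cases hv : v = w
    · subst hv
      exact ⟨u, SimpleGraph.Reachable.refl _, h⟩
    · obtain ⟨z, hz, hzx⟩ := ih hv
      have : (isolate G w).Adj u v := ⟨h, hy, hv⟩
      exact ⟨z, this.reachable.trans hz, hzx⟩

namespace IsAmalgam

variable {C V : Type*} [Fintype C] [Fintype V] {b : V → ℕ} {μ : C → V → V → ℕ}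
  {act : C → V → Prop}

theorem adj_iff (h : IsAmalgam b μ act) (c : C) (x y : V) :
    (multiplicityGraph (μ c)).Adj x y ↔ x ≠ y ∧ μ c x y ≠ 0 := by
  simp [multiplicityGraph, h.symm c y x]

theorem even_deg (h : IsAmalgam b μ act) (c : C) (x : V) : Even (∑ y, μ c x y) := by
  by_cases hx : act c x
  · rw [h.deg_act c x hx]; exact even_two_mul _
  · rw [h.deg_not_act c x hx]; exact Even.zero

open Classical in
/-- The edges at a group `x` of at least two vertices that are handed to one vertex of it. -/
theorem exists_selection (h : IsAmalgam b μ act) (x : V) (hx : 2 ≤ b x) :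
    ∃ s : C → V → ℕ, (∀ c, act c x → ∑ y, s c y = 2) ∧ (∀ c y, s c y ≤ μ c x y) ∧
      (∀ c, 2 * s c x ≤ μ c x x) ∧ (∀ y, y ≠ x → ∑ c, s c y = b y) ∧ (∑ c, s c x = b x - 1) ∧
      ∀ c y,
        ∑ z with (isolate (multiplicityGraph (μ c)) x).Reachable y z, μ c x z = 2 →
        ∑ z with (isolate (multiplicityGraph (μ c)) x).Reachable y z, s c z ≤ 1 := by
  have hb0 : (0 : ℝ) < b x := by exact_mod_cast (by omega : 0 < b x)
  have hb2 : (2 : ℝ) ≤ b x := by exact_mod_cast hx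
  -- The new vertex should get the fraction `1 / b x` of the edges from `x` to each `y` in each
  -- colour. The blocks are the components of the colour class away from `x`, labelled by their
  -- vertex sets.
  obtain ⟨g, hg1, hg2, hg3, hg4⟩ := exists_integral_table
    (fun c y => {z | (isolate (multiplicityGraph (μ c)) x).Reachable y z})
    (fun c y => (μ c x y : ℝ) / b x) (fun c => if act c x then 2 else 0)
    (fun y => if y = x then (b x : ℤ) - 1 else b y) (by
      intro c
      rw [← Finset.sum_div, ← Nat.cast_sum]
      split_ifs with hc
      · rw [h.deg_act c x hc]
        push_cast
        field_simp
      · rw [h.deg_not_act c x hc]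
        simp) (by
      intro y
      rw [← Finset.sum_div, ← Nat.cast_sum]
      split_ifs with hy
      · rw [hy, h.sum_diag x]
        push_cast [Nat.cast_sub (h.pos x)]
        field_simp
      · rw [h.sum_off x y (Ne.symm hy)]
        push_cast
        field_simp)
  have hg0 : ∀ c y, 0 ≤ g c y := fun c y =>
    le_trans (Int.floor_nonneg.2 (by positivity)) (hg3 c y).1
  have hcast : ∀ c y, ((g c y).toNat : ℤ) = g c y := fun c y => Int.toNat_of_nonneg (hg0 c y)
  refine ⟨fun c y => (g c y).toNat, fun c hc => ?_, fun c y => ?_, fun c => ?_, fun y hy => ?_, ?_,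
    fun c y hy => ?_⟩
  · have := hg1 c
    rw [if_pos hc] at this
    zify
    simp only [hcast]
    exact this
  · zify
    rw [hcast]
    refine (hg3 c y).2.trans (Int.ceil_le.2 ?_)
    rw [div_le_iff₀ hb0]
    push_cast
    nlinarith [(Nat.cast_nonneg (μ c x y) : (0 : ℝ) ≤ _)]
  -- There are `k` loops at `x`, and the share `2k / b x` is at most `k` since `b x ≥ 2`. A loop
  -- that is handed over becomes an edge from the new vertex to `x`.
  · obtain ⟨k, hk⟩ := h.even_diag c x
    have : g c x ≤ k := by
      refine (hg3 c x).2.trans (Int.ceil_le.2 ?_)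
      rw [div_le_iff₀ hb0, hk]
      push_cast
      nlinarith [(Nat.cast_nonneg k : (0 : ℝ) ≤ _)]
    have := hcast c x
    change 2 * (g c x).toNat ≤ μ c x x
    omega
  · have := hg2 y
    rw [if_neg hy] at this
    zify
    simp only [hcast]
    exact this
  · have := hg2 x
    rw [if_pos rfl] at this
    zify [h.pos x]
    simp only [hcast]
    exact this
  · have hset : ∀ z, {w | (isolate (multiplicityGraph (μ c)) x).Reachable z w} =
        {w | (isolate (multiplicityGraph (μ c)) x).Reachable y w} ↔
        (isolate (multiplicityGraph (μ c)) x).Reachable y z := by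
      intro z
      constructor
      · intro hz
        have : z ∈ {w | (isolate (multiplicityGraph (μ c)) x).Reachable z w} :=
          SimpleGraph.Reachable.refl _
        rwa [hz] at this
      · intro hz
        ext w
        exact ⟨fun hw => hz.trans hw, fun hw => hz.symm.trans hw⟩
    have := hg4 c {w | (isolate (multiplicityGraph (μ c)) x).Reachable y w}
    simp only [hset] at this
    rw [← Finset.sum_div, ← Nat.cast_sum, hy] at this
    zify
    simp only [hcast]
    -- A component tied to `x` by two edges has share `2 / b x ≤ 1`, so it cannot lose both.
    refine this.trans (Int.ceil_le.2 ?_)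
    rw [div_le_iff₀ hb0]
    push_cast
    linarith

open Classical in
/-- Weights after one vertex is split off the group `x`. -/
noncomputable def splitWeight (b : V → ℕ) (x : V) : Option V → ℕ
  | none => 1
  | some y => if y = x then b x - 1 else b y

open Classical in
/-- Multiplicities after one vertex is split off the group `x`, taking along the edges `s`. -/
noncomputable def splitMult (μ : V → V → ℕ) (s : V → ℕ) (x : V) : Option V → Option V → ℕ
  | none, none => 0
  | none, some y => s y
  | some y, none => s y
  | some y, some z =>
    if y = x then (if z = x then μ x x - 2 * s x else μ x z - s z)
    else if z = x then μ y x - s y else μ y z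

-- The danger is that the new vertex `none` takes away every edge by which some component `K` off
-- `x` was tied to `x`. Their number is even by `even_cut` and at most 2, so it would be exactly 2,
-- which `hs3` forbids. Hence `none` is joined to `x` through `K`, or directly if it took a loop,
-- and every other vertex reaches `x` or `none` through its own component.
open Classical in
theorem reachable_split (h : IsAmalgam b μ act) (x : V) (s : C → V → ℕ)
    (hs1 : ∀ c, act c x → ∑ y, s c y = 2) (hs2 : ∀ c y, s c y ≤ μ c x y)
    (hs3 : ∀ c y,
        ∑ z with (isolate (multiplicityGraph (μ c)) x).Reachable y z, μ c x z = 2 →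
        ∑ z with (isolate (multiplicityGraph (μ c)) x).Reachable y z, s c z ≤ 1)
    (c : C) (hc : act c x) (o : Option V) (ho : act c (o.getD x)) :
    (multiplicityGraph (splitMult (μ c) (s c) x)).Reachable o (some x) := by
  set G := multiplicityGraph (μ c) with hG
  set G' := multiplicityGraph (splitMult (μ c) (s c) x) with hG'
  have lift : ∀ y z, y ≠ x → (isolate G x).Reachable y z → G'.Reachable (some y) (some z) := by
    intro y z hy hyz
    obtain ⟨p⟩ := hyz
    induction p with
    | nil => exact SimpleGraph.Reachable.refl _
    | @cons u v w huv _ ih =>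
      obtain ⟨h1, h2, h3⟩ := huv
      refine SimpleGraph.Reachable.trans (SimpleGraph.Adj.reachable ?_) (ih h3)
      have := (h.adj_iff c u v).1 h1
      simp [hG', multiplicityGraph, splitMult, h2, h3, this.1, this.2]
  have adj_none : ∀ z, s c z ≠ 0 → G'.Adj (some z) none := by
    intro z hz
    simp [hG', multiplicityGraph, splitMult, hz]
  have adj_x : ∀ z, z ≠ x → s c z < μ c x z → G'.Adj (some z) (some x) := by
    intro z hz hlt
    have : μ c x z - s c z ≠ 0 := by omega
    simp [hG', multiplicityGraph, splitMult, hz, this]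
  have hnone : G'.Reachable none (some x) := by
    by_cases hsx : s c x = 0
    · have : ∃ y, s c y ≠ 0 := by
        by_contra h0
        push Not at h0
        have := hs1 c hc
        simp [h0] at this
      obtain ⟨y, hy⟩ := this
      have hyx : y ≠ x := fun h0 => hy (h0 ▸ hsx)
      by_cases hz : ∃ z, (isolate G x).Reachable y z ∧ s c z < μ c x z
      · obtain ⟨z, hz1, hz2⟩ := hz
        exact (adj_none y hy).symm.reachable.trans ((lift y z hyx hz1).trans
          (adj_x z (reachable_isolate_ne hz1 hyx) hz2).reachable)
      · exfalso
        push Not at hz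
        set K := Finset.univ.filter fun z => (isolate G x).Reachable y z with hK
        have hsK : ∑ z ∈ K, s c z = ∑ z ∈ K, μ c x z :=
          Finset.sum_congr rfl fun z hz' => le_antisymm (hs2 c z) (hz z (by simpa [hK] using hz'))
        have hle : ∑ z ∈ K, s c z ≤ 2 := by
          rw [← hs1 c hc]
          exact Finset.sum_le_sum_of_subset (Finset.subset_univ _)
        have hge : s c y ≤ ∑ z ∈ K, s c z :=
          Finset.single_le_sum (f := s c) (fun _ _ => Nat.zero_le _)
            (by simp only [hK, Finset.mem_filter, Finset.mem_univ, true_and]; exact SimpleGraph.Reachable.refl _)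
        have heven : Even (∑ z ∈ K, μ c x z) := by
          refine even_cut (μ c) (h.symm c) (h.even_diag c) (h.even_deg c) x K ?_ ?_
          · intro hxK
            exact reachable_isolate_ne (by simpa [hK] using hxK) hyx rfl
          · intro z hzK w hwK hwx
            by_contra h0
            have hz' : (isolate G x).Reachable y z := by simpa [hK] using hzK
            have hzx := reachable_isolate_ne hz' hyx
            apply hwK
            simp only [hK, Finset.mem_filter, Finset.mem_univ, true_and]
            by_cases hzw : z = w
            · exact hzw ▸ hz'
            · have : (isolate G x).Adj z w := ⟨(h.adj_iff c z w).2 ⟨hzw, h0⟩, hzx, hwx⟩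
              exact hz'.trans this.reachable
        have h2 : ∑ z ∈ K, μ c x z = 2 := by
          obtain ⟨k, hk⟩ := heven
          omega
        have h1 : ∑ z ∈ K, s c z ≤ 1 := hs3 c y h2
        omega
    · exact (adj_none x hsx).symm.reachable
  cases o with
  | none => exact hnone
  | some y =>
    by_cases hyx : y = x
    · rw [hyx]
    · obtain ⟨z, hz, hzx⟩ := exists_reachable_isolate (h.conn c y x ho hc) hyx
      have hzne := reachable_isolate_ne hz hyx
      refine (lift y z hyx hz).trans ?_
      by_cases h0 : s c z = 0
      · refine (adj_x z hzne ?_).reachable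
        have := ((h.adj_iff c z x).1 hzx).2
        rw [h.symm c z x] at this
        omega
      · exact (adj_none z h0).reachable.trans hnone

/-- The last clause says that splitting creates no edges between groups that had none in that
colour; it later keeps the spanning colours out of the smaller part. -/
theorem exists_split (h : IsAmalgam b μ act) (x : V) (hx : 2 ≤ b x) :
    ∃ μ' : C → Option V → Option V → ℕ,
      IsAmalgam (splitWeight b x) μ' (fun c o => act c (o.getD x)) ∧
      ∀ c o o', μ' c o o' ≠ 0 → μ c (o.getD x) (o'.getD x) ≠ 0 := by
  classical
  obtain ⟨s, hs1, hs2, hs3, hs4, hs5, hs6⟩ := h.exists_selection x hx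
  have hs0 : ∀ c, ¬ act c x → ∀ y, μ c x y = 0 ∧ s c y = 0 := by
    intro c hc y
    have h0 := h.deg_not_act c x hc
    have := (Finset.sum_eq_zero_iff.1 h0) y (Finset.mem_univ y)
    have h1 := hs2 c y
    exact ⟨this, by omega⟩
  have degx : ∀ c, ∑ o, splitMult (μ c) (s c) x (some x) o + ∑ y, s c y = ∑ y, μ c x y := by
    intro c
    rw [Fintype.sum_option, ← Finset.add_sum_erase _ _ (Finset.mem_univ x),
      ← Finset.add_sum_erase _ (s c) (Finset.mem_univ x),
      ← Finset.add_sum_erase _ (μ c x) (Finset.mem_univ x)]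
    have e1 : ∑ y ∈ Finset.univ.erase x, splitMult (μ c) (s c) x (some x) (some y)
        + ∑ y ∈ Finset.univ.erase x, s c y = ∑ y ∈ Finset.univ.erase x, μ c x y := by
      rw [← Finset.sum_add_distrib]
      refine Finset.sum_congr rfl fun y hy => ?_
      have hyx : y ≠ x := Finset.ne_of_mem_erase hy
      have := hs2 c y
      simp only [splitMult, if_true, if_neg hyx]
      omega
    have e2 := hs3 c
    have e3 : splitMult (μ c) (s c) x (some x) (some x) = μ c x x - 2 * s c x := by simp [splitMult]
    have e4 : splitMult (μ c) (s c) x (some x) none = s c x := rfl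
    omega
  have degy : ∀ c y, y ≠ x → ∑ o, splitMult (μ c) (s c) x (some y) o = ∑ z, μ c y z := by
    intro c y hy
    rw [Fintype.sum_option, ← Finset.add_sum_erase _ _ (Finset.mem_univ x),
      ← Finset.add_sum_erase _ (μ c y) (Finset.mem_univ x)]
    have e1 : ∑ z ∈ Finset.univ.erase x, splitMult (μ c) (s c) x (some y) (some z)
        = ∑ z ∈ Finset.univ.erase x, μ c y z := by
      refine Finset.sum_congr rfl fun z hz => ?_
      simp only [splitMult, if_neg hy, if_neg (Finset.ne_of_mem_erase hz)]
    have e2 := hs2 c y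
    have e3 : splitMult (μ c) (s c) x (some y) (some x) = μ c y x - s c y := by simp [splitMult, hy]
    have e4 : splitMult (μ c) (s c) x (some y) none = s c y := rfl
    have e5 := h.symm c x y
    omega
  have degn : ∀ c, ∑ o, splitMult (μ c) (s c) x none o = ∑ y, s c y := by
    intro c
    rw [Fintype.sum_option]
    simp [splitMult]
  refine ⟨fun c => splitMult (μ c) (s c) x, ⟨?_, ?_, ?_, ?_, ?_, ?_, ?_, ?_⟩, ?_⟩
  · rintro (_ | y)
    · exact le_rfl
    · simp only [splitWeight]
      split_ifs
      · omega
      · exact h.pos y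
  · rintro c (_ | y) (_ | z) <;> simp only [splitMult]
    split_ifs with h1 h2 h2
    · rfl
    · rw [h.symm c z x]
    · rw [h.symm c x y]
    · rw [h.symm c y z]
  · rintro c (_ | y) <;> simp only [splitMult]
    · exact Even.zero
    · split_ifs with h1
      · obtain ⟨k, hk⟩ := h.even_diag c x
        exact ⟨k - s c x, by omega⟩
      · exact h.even_diag c y
  · have off1 : ∀ y, ∑ c, s c y = splitWeight b x (some y) := by
      intro y
      simp only [splitWeight]
      split_ifs with hy
      · rw [hy, hs5]
      · rw [hs4 y hy]
    have off2 : ∀ z, z ≠ x → ∑ c, (μ c x z - s c z) = (b x - 1) * b z := by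
      intro z hz
      rw [Finset.sum_tsub_distrib _ (fun c _ => hs2 c z), h.sum_off x z (Ne.symm hz), hs4 z hz,
        Nat.sub_mul, one_mul]
    rintro (_ | y) (_ | z) hyz
    · exact absurd rfl hyz
    · simp only [splitMult, off1]
      simp [splitWeight]
    · simp only [splitMult, off1]
      simp [splitWeight]
    · have hyz' : y ≠ z := fun h0 => hyz (by rw [h0])
      simp only [splitMult, splitWeight]
      by_cases hy : y = x
      · have hz : z ≠ x := fun h0 => hyz' (hy.trans h0.symm)
        simp only [hy, hz, if_true, if_false]
        exact off2 z hz
      · by_cases hz : z = x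
        · simp only [hy, hz, if_true, if_false]
          simp only [h.symm _ y x]
          rw [off2 y hy, mul_comm]
        · simp only [hy, hz, if_false]
          exact h.sum_off y z hyz'
  · rintro (_ | y)
    · simp [splitMult, splitWeight]
    · simp only [splitMult, splitWeight]
      split_ifs with hy
      -- With `b = b x`, the new diagonal sum is `b(b-1) - 2(b-1) = (b-1)(b-2)`.
      · rw [Finset.sum_tsub_distrib _ (fun c _ => hs3 c), h.sum_diag x, ← Finset.mul_sum, hs5]
        obtain ⟨k, hk⟩ : ∃ k, b x = k + 2 := ⟨b x - 2, by omega⟩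
        rw [hk]
        simp only [show k + 2 - 1 = k + 1 by omega, show k + 1 - 1 = k by omega]
        rw [← Nat.sub_mul, mul_comm]
        simp
      · exact h.sum_diag y
  · rintro c (_ | y) hc
    · rw [degn, hs1 c hc]
      rfl
    · by_cases hy : y = x
      · rw [Option.getD_some, hy] at hc
        have := degx c
        rw [hs1 c hc, h.deg_act c x hc] at this
        rw [hy]
        simp only [splitWeight, if_true]
        omega
      · rw [degy c y hy, h.deg_act c y hc]
        simp [splitWeight, hy]
  · rintro c (_ | y) hc
    · rw [degn]
      exact Finset.sum_eq_zero fun y _ => (hs0 c hc y).2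
    · by_cases hy : y = x
      · rw [Option.getD_some, hy] at hc
        have := degx c
        rw [h.deg_not_act c x hc] at this
        rw [hy]
        omega
      · rw [degy c y hy, h.deg_not_act c y hc]
  · intro c o o' ho ho'
    -- A colour that does not cover `x` has no edges there, so its class is carried over unchanged
    -- by `some`.
    by_cases hc : act c x
    · exact (h.reachable_split x s hs1 hs2 hs6 c hc o ho).trans
        (h.reachable_split x s hs1 hs2 hs6 c hc o' ho').symm
    · obtain ⟨y, rfl⟩ : ∃ y, o = some y := by
        cases o with
        | none => exact absurd ho hc
        | some y => exact ⟨y, rfl⟩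
      obtain ⟨z, rfl⟩ : ∃ z, o' = some z := by
        cases o' with
        | none => exact absurd ho' hc
        | some z => exact ⟨z, rfl⟩
      let φ : multiplicityGraph (μ c) →g multiplicityGraph (splitMult (μ c) (s c) x) :=
        { toFun := some
          map_rel' := by
            intro u v huv
            obtain ⟨h1, h2⟩ := (h.adj_iff c u v).1 huv
            have hu : u ≠ x := by rintro rfl; exact h2 (hs0 c hc v).1
            have hv : v ≠ x := by rintro rfl; rw [h.symm] at h2; exact h2 (hs0 c hc u).1
            simp [multiplicityGraph, splitMult, hu, hv, h1, h2] }
      exact (h.conn c y z ho ho').map φ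
  · rintro c (_ | y) (_ | z) hne <;> simp only [splitMult, Option.getD_none, Option.getD_some] at hne ⊢
    · exact absurd rfl hne
    · have := hs2 c z
      omega
    · have := hs2 c y
      rw [h.symm c y x]
      omega
    · split_ifs at hne with h1 h2 h2
      · rw [h1, h2]
        omega
      · rw [h1]
        omega
      · rw [h2]
        omega
      · exact hne

end IsAmalgam

/-- Every amalgam is obtained by merging vertices in a decomposition of a complete graph. -/
theorem exists_detachment {C : Type} [Fintype C] {V : Type} [Fintype V] (b : V → ℕ)
    (μ : C → V → V → ℕ) (act : C → V → Prop) (h : IsAmalgam b μ act) :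
    ∃ (W : Type) (_ : Fintype W) (π : W → V) (μ' : C → W → W → ℕ),
      IsAmalgam (fun _ => 1) μ' (fun c w => act c (π w)) ∧
      (∀ c x y, μ' c x y ≠ 0 → μ c (π x) (π y) ≠ 0) ∧ ∀ x, {w | π w = x}.ncard = b x := by
  classical
  -- The sum counts the vertices still to be split off; when it is zero all weights are one.
  induction hk : ∑ x, (b x - 1) generalizing V with
  | zero =>
    have hb : b = fun _ => 1 := by
      ext x
      have h1 := Finset.sum_eq_zero_iff.1 hk x (Finset.mem_univ x)
      have h2 := h.pos x
      omega
    subst hb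
    exact ⟨V, inferInstance, id, μ, h, fun _ _ _ => id, fun x => by simp⟩
  | succ k ih =>
    obtain ⟨x, hx⟩ : ∃ x, 2 ≤ b x := by
      by_contra h0
      push Not at h0
      rw [Finset.sum_eq_zero] at hk
      · omega
      · intro x _
        have := h0 x
        omega
    obtain ⟨μ₁, h₁, hne₁⟩ := h.exists_split x hx
    obtain ⟨W, hW, π, μ', h', hne', hπ⟩ := ih _ _ _ h₁ (by
      rw [Fintype.sum_option]
      rw [← Finset.add_sum_erase _ _ (Finset.mem_univ x)] at hk ⊢
      have : ∑ y ∈ Finset.univ.erase x, (IsAmalgam.splitWeight b x (some y) - 1)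
          = ∑ y ∈ Finset.univ.erase x, (b y - 1) :=
        Finset.sum_congr rfl fun y hy => by
          simp [IsAmalgam.splitWeight, Finset.ne_of_mem_erase hy]
      rw [this]
      simp only [IsAmalgam.splitWeight, if_true]
      omega)
    refine ⟨W, hW, fun w => (π w).getD x, μ', h',
      fun c y z h0 => hne₁ c _ _ (hne' c y z h0), fun y => ?_⟩
    by_cases hy : y = x
    · subst hy
      have e : {w | (π w).getD y = y} = {w | π w = none} ∪ {w | π w = some y} := by
        ext w
        simp only [Set.mem_ofPred_eq, Set.mem_union]
        cases π w <;> simp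
      rw [e, Set.ncard_union_eq, hπ, hπ]
      · simp only [IsAmalgam.splitWeight, if_true]
        omega
      · rw [Set.disjoint_left]
        intro w h1 h2
        rw [Set.mem_ofPred_eq] at h1 h2
        rw [h1] at h2
        exact absurd h2 (by simp)
    · have e : {w | (π w).getD x = y} = {w | π w = some y} := by
        ext w
        simp only [Set.mem_ofPred_eq]
        cases π w <;> simp [Ne.symm hy]
      rw [e, hπ]
      simp [IsAmalgam.splitWeight, hy]

/-! ### Bipartite 2-factors as zigzag graphs. -/

/-- Adjacency in the cycle `0, 1, …, N - 1`. -/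
def CycleAdj (N i j : ℕ) : Prop :=
  j = i + 1 ∨ i = j + 1 ∨ (i = 0 ∧ j + 1 = N) ∨ (j = 0 ∧ i + 1 = N)

/-- The closed walk of length `N` is included so that a 2-colouring can force `N` to be even. -/
theorem exists_cycle_enumeration {V : Type*} [Finite V] {G : SimpleGraph V} (hG : G.IsCycles) (x : V)
    (hx : (G.neighborSet x).Nonempty) :
    ∃ (N : ℕ) (f : ℕ → V), 3 ≤ N ∧ (∃ p : G.Walk x x, p.length = N) ∧
      Set.BijOn f (Set.Iio N) {y | G.Reachable x y} ∧
      ∀ i < N, ∀ j < N, G.Adj (f i) (f j) ↔ CycleAdj N i j := by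
  obtain ⟨p, hp, hpc⟩ := hG.exists_cycle_toSubgraph_verts_eq_connectedComponentSupp
    (c := G.connectedComponentMk x) (v := x) rfl hx
  have h3 := hp.three_le_length
  have hinj : Set.InjOn p.getVert (Set.Iio p.length) := by
    intro i hi j hj hij
    rw [Set.mem_Iio] at hi hj
    exact hp.getVert_injOn' (by rw [Set.mem_ofPred_eq]; omega) (by rw [Set.mem_ofPred_eq]; omega) hij
  have hlast : p.getVert p.length = p.getVert 0 := by simp
  have hadj : ∀ i < p.length, ∀ j < p.length, CycleAdj p.length i j →
      G.Adj (p.getVert i) (p.getVert j) := by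
    rintro i hi j hj (h | h | ⟨h, h'⟩ | ⟨h, h'⟩)
    · rw [h]; exact p.adj_getVert_succ hi
    · rw [h]; exact (p.adj_getVert_succ hj).symm
    · have := p.adj_getVert_succ hj
      rw [h', hlast, ← h] at this
      exact this.symm
    · have := p.adj_getVert_succ hi
      rw [h', hlast, ← h] at this
      exact this
  refine ⟨p.length, p.getVert, h3, ⟨p, rfl⟩, ⟨?_, hinj, ?_⟩, ?_⟩
  · intro i _
    exact (p.take i).reachable
  · intro y hy
    have hy' : y ∈ p.toSubgraph.verts := by
      rw [hpc]
      simpa using SimpleGraph.Reachable.symm hy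
    rw [SimpleGraph.Walk.mem_verts_toSubgraph, SimpleGraph.Walk.mem_support_iff_exists_getVert] at hy'
    obtain ⟨n, hn, hn'⟩ := hy'
    rcases hn'.lt_or_eq with h | h
    · exact ⟨n, h, hn⟩
    · refine ⟨0, Set.mem_Iio.2 (by omega), ?_⟩
      rw [← hn, h, hlast]
  · intro i hi j hj
    refine ⟨fun h => ?_, hadj i hi j hj⟩
    -- The two cyclic neighbours of `i` already use up the degree of `p.getVert i`, so the cycle has
    -- no chords.
    obtain ⟨k, l, hk, hl, hkl, hck, hcl, hall⟩ : ∃ k l, k < p.length ∧ l < p.length ∧ k ≠ l ∧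
        CycleAdj p.length i k ∧ CycleAdj p.length i l ∧
        ∀ m < p.length, CycleAdj p.length i m → m = k ∨ m = l := by
      unfold CycleAdj
      by_cases h0 : i = 0
      · exact ⟨1, p.length - 1, by omega, by omega, by omega, by omega, by omega, fun m _ _ => by omega⟩
      · by_cases h1 : i + 1 = p.length
        · exact ⟨0, i - 1, by omega, by omega, by omega, by omega, by omega, fun m _ _ => by omega⟩
        · exact ⟨i + 1, i - 1, by omega, by omega, by omega, by omega, by omega, fun m _ _ => by omega⟩
    have hcard : (G.neighborSet (p.getVert i)).ncard = 2 := hG ⟨_, h⟩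
    have hne : p.getVert k ≠ p.getVert l := fun h0 => hkl (hinj hk hl h0)
    have hsub : {p.getVert k, p.getVert l} ⊆ G.neighborSet (p.getVert i) := by
      rintro z (rfl | rfl)
      · exact hadj i hi k hk hck
      · exact hadj i hi l hl hcl
    have heq := Set.eq_of_subset_of_ncard_le hsub (by rw [hcard, Set.ncard_pair hne]) (Set.toFinite _)
    have hjm : p.getVert j ∈ G.neighborSet (p.getVert i) := h
    rw [← heq] at hjm
    rcases hjm with h0 | h0
    · rw [hinj hj hk h0]; exact hck
    · rw [hinj hj hl h0]; exact hcl

/-- Upward adjacency in the zigzag graph on `0, 1, …, 2N - 1` with break points `D`: two consecutive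
break points `p`, `q` enclose a cycle on `2p, …, 2q - 1`, listed alternately from both sides. -/
def ZigzagLt (D : ℕ → Prop) (x y : ℕ) : Prop :=
  (x % 2 = 0 ∧ y = x + 2 ∧ ¬ D (x / 2 + 1)) ∨ (x % 2 = 1 ∧ y = x + 2 ∧ ¬ D ((x + 1) / 2)) ∨
    (x % 2 = 0 ∧ y = x + 1 ∧ (D (x / 2) ∨ D (x / 2 + 1)))

/-- Adjacency in the zigzag graph with break points `D`. -/
def Zigzag (D : ℕ → Prop) (x y : ℕ) : Prop := ZigzagLt D x y ∨ ZigzagLt D y x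

theorem zigzagLt_shift {D D' : ℕ → Prop} {M K : ℕ} (h : ∀ i ≤ M, D' (K + i) ↔ D i) {x y : ℕ}
    (hx : x < 2 * M) : ZigzagLt D' (2 * K + x) (2 * K + y) ↔ ZigzagLt D x y := by
  have e1 : (2 * K + x) / 2 = K + x / 2 := by omega
  have e2 : (2 * K + x + 1) / 2 = K + (x + 1) / 2 := by omega
  have e3 : (2 * K + x) % 2 = x % 2 := by omega
  have e4 : 2 * K + y = 2 * K + x + 2 ↔ y = x + 2 := by omega
  have e5 : 2 * K + y = 2 * K + x + 1 ↔ y = x + 1 := by omega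
  simp only [ZigzagLt, e1, e2, e3, e4, e5, add_assoc K]
  rw [h _ (by omega), h _ (by omega), h _ (by omega)]

theorem zigzag_shift {D D' : ℕ → Prop} {M K : ℕ} (h : ∀ i ≤ M, D' (K + i) ↔ D i) {x y : ℕ}
    (hx : x < 2 * M) (hy : y < 2 * M) : Zigzag D' (2 * K + x) (2 * K + y) ↔ Zigzag D x y :=
  or_congr (zigzagLt_shift h hx) (zigzagLt_shift h hy)

/-- The place, in cyclic order, of the vertex `y` of the zigzag cycle of length `2a`. -/
def zigzagPlace (a y : ℕ) : ℕ :=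
  if y % 2 = 1 then (y + 1) / 2 else if y = 0 then 0 else 2 * a - y / 2

theorem zigzagPlace_lt {a y : ℕ} (hy : y < 2 * a) : zigzagPlace a y < 2 * a := by
  unfold zigzagPlace
  split_ifs <;> omega

theorem zigzagPlace_inj {a x y : ℕ} (hx : x < 2 * a) (hy : y < 2 * a)
    (h : zigzagPlace a x = zigzagPlace a y) : x = y := by
  unfold zigzagPlace at h
  split_ifs at h <;> omega

theorem surjOn_zigzagPlace (a : ℕ) :
    Set.SurjOn (zigzagPlace a) (Set.Iio (2 * a)) (Set.Iio (2 * a)) := by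
  intro t ht
  rw [Set.mem_Iio] at ht
  by_cases h : t ≤ a
  · by_cases h0 : t = 0
    · exact ⟨0, by rw [Set.mem_Iio]; omega, by simp [zigzagPlace, h0]⟩
    · refine ⟨2 * t - 1, by rw [Set.mem_Iio]; omega, ?_⟩
      rw [zigzagPlace, if_pos (by omega)]
      omega
  · refine ⟨2 * (2 * a - t), by rw [Set.mem_Iio]; omega, ?_⟩
    rw [zigzagPlace, if_neg (by omega), if_neg (by omega)]
    omega

/-- Positions `2 * i` and `2 * i + 1` form column `i` of a ladder. Rails join consecutive columns
except across a break point, and rungs occur only in the columns next to a break point, so each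
stretch between consecutive break points closes up to a cycle. -/
theorem zigzagLt_even_even (D : ℕ → Prop) (i j : ℕ) :
    ZigzagLt D (2 * i) (2 * j) ↔ j = i + 1 ∧ ¬ D (i + 1) := by
  have e1 : 2 * i / 2 = i := by omega
  have e2 : 2 * i % 2 = 0 := by omega
  have e3 : 2 * j = 2 * i + 2 ↔ j = i + 1 := by omega
  have e4 : ¬ 2 * j = 2 * i + 1 := by omega
  simp only [ZigzagLt, e1, e2, e3, e4]
  tauto

theorem zigzagLt_even_odd (D : ℕ → Prop) (i j : ℕ) :
    ZigzagLt D (2 * i) (2 * j + 1) ↔ j = i ∧ (D i ∨ D (i + 1)) := by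
  have e1 : 2 * i / 2 = i := by omega
  have e2 : 2 * i % 2 = 0 := by omega
  have e3 : 2 * j + 1 = 2 * i + 1 ↔ j = i := by omega
  have e4 : ¬ 2 * j + 1 = 2 * i + 2 := by omega
  simp only [ZigzagLt, e1, e2, e3, e4]
  tauto

theorem zigzagLt_odd_odd (D : ℕ → Prop) (i j : ℕ) :
    ZigzagLt D (2 * i + 1) (2 * j + 1) ↔ j = i + 1 ∧ ¬ D (i + 1) := by
  have e1 : (2 * i + 1 + 1) / 2 = i + 1 := by omega
  have e2 : (2 * i + 1) % 2 = 1 := by omega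
  have e3 : 2 * j + 1 = 2 * i + 1 + 2 ↔ j = i + 1 := by omega
  simp only [ZigzagLt, e1, e2, e3]
  simp

theorem not_zigzagLt_odd_even (D : ℕ → Prop) (i j : ℕ) : ¬ ZigzagLt D (2 * i + 1) (2 * j) := by
  have e2 : (2 * i + 1) % 2 = 1 := by omega
  have e4 : ¬ 2 * j = 2 * i + 1 + 2 := by omega
  simp [ZigzagLt, e2, e4]

theorem zigzagPlace_odd (a i : ℕ) : zigzagPlace a (2 * i + 1) = i + 1 := by
  rw [zigzagPlace, if_pos (by omega)]
  omega

theorem zigzagPlace_even (a i : ℕ) : zigzagPlace a (2 * i) = if i = 0 then 0 else 2 * a - i := by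
  rw [zigzagPlace, if_neg (by omega)]
  split_ifs <;> omega

/-- The cyclic order is `0, 1, 3, …, 2a-1, 2a-2, …, 4, 2`: along the odd rail and back along the
even one. -/
theorem cycleAdj_zigzagPlace {a x y : ℕ} (ha : 2 ≤ a) (hx : x < 2 * a) (hy : y < 2 * a) :
    CycleAdj (2 * a) (zigzagPlace a x) (zigzagPlace a y) ↔
      Zigzag (fun i => i = 0 ∨ i = a) x y := by
  unfold CycleAdj Zigzag
  obtain ⟨i, rfl | rfl⟩ : ∃ i, x = 2 * i ∨ x = 2 * i + 1 := ⟨x / 2, by omega⟩ <;>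
  obtain ⟨j, rfl | rfl⟩ : ∃ j, y = 2 * j ∨ y = 2 * j + 1 := ⟨y / 2, by omega⟩ <;>
  simp only [zigzagLt_even_even, zigzagLt_even_odd, zigzagLt_odd_odd, not_zigzagLt_odd_even,
    zigzagPlace_odd, zigzagPlace_even, or_false, false_or]
  · split_ifs <;> grind
  · split_ifs <;> grind
  · split_ifs <;> grind
  · omega

/-- The cycles are appended one by one, `k` counting the vertices not yet placed. The placed
vertices form a union of components, so the cycle through an unplaced vertex avoids them; it has
even length `2a` by bipartiteness and becomes a block ending at the break point `N + a`. -/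
theorem exists_zigzag_extension {V : Type*} [Finite V] {H : SimpleGraph V} (hf : IsFactor 2 H)
    (hb : H.IsBipartite) (k : ℕ) : ∀ (N : ℕ) (D : ℕ → Prop) (g : ℕ → V),
    Set.InjOn g (Set.Iio (2 * N)) →
    (∀ y z, y ∈ g '' Set.Iio (2 * N) → H.Adj y z → z ∈ g '' Set.Iio (2 * N)) →
    D 0 → D N → (∀ i, D i → i ≤ N) → (∀ i, D i → ¬ D (i + 1)) →
    (∀ x < 2 * N, ∀ y < 2 * N, H.Adj (g x) (g y) ↔ Zigzag D x y) →
    Nat.card V = 2 * N + k →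
    ∃ (N' : ℕ) (D' : ℕ → Prop) (g' : ℕ → V), Nat.card V = 2 * N' ∧
      Set.InjOn g' (Set.Iio (2 * N')) ∧ D' 0 ∧ D' N' ∧ (∀ i, D' i → ¬ D' (i + 1)) ∧
      ∀ x < 2 * N', ∀ y < 2 * N', H.Adj (g' x) (g' y) ↔ Zigzag D' x y := by
  induction k using Nat.strong_induction_on with
  | _ k ih =>
  intro N D g hinj hcl hD0 hDN hDle hDc hadj hcard
  rcases Nat.eq_zero_or_pos k with rfl | hk
  · exact ⟨N, D, g, hcard, hinj, hD0, hDN, hDc, hadj⟩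
  have himg : (g '' Set.Iio (2 * N)).ncard = 2 * N := by
    rw [hinj.ncard_image, Set.ncard_eq_toFinset_card']
    simp
  obtain ⟨x, hx⟩ : ∃ x, x ∉ g '' Set.Iio (2 * N) := by
    by_contra h0
    push Not at h0
    rw [Set.eq_univ_of_forall h0, Set.ncard_univ] at himg
    omega
  have hcyc : H.IsCycles := fun v _ => hf v
  have hnx : (H.neighborSet x).Nonempty := by
    apply Set.nonempty_of_ncard_ne_zero
    rw [hf x]
    omega
  obtain ⟨L, f, hL, ⟨p, hp⟩, hbij, hfadj⟩ := exists_cycle_enumeration hcyc x hnx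
  obtain ⟨c⟩ := hb
  obtain ⟨a, ha⟩ : Even L := by
    have c' : H.Coloring Bool :=
      SimpleGraph.Coloring.mk (fun v => decide (c v = 0)) (by
        intro v w hvw
        have := c.valid hvw
        intro h0
        apply this
        have h0' : c v = 0 ↔ c w = 0 := by simpa using h0
        omega)
    rw [← hp, c'.even_length_iff_congr p]
  have ha2 : L = 2 * a := by omega
  subst ha2
  have hclr : ∀ y z, H.Reachable y z → y ∈ g '' Set.Iio (2 * N) → z ∈ g '' Set.Iio (2 * N) := by
    rintro y z ⟨q⟩
    induction q with
    | nil => exact id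
    | cons h _ ih => exact fun hy => ih (hcl _ _ hy h)
  have hout : ∀ t < 2 * a, f t ∉ g '' Set.Iio (2 * N) := by
    intro t ht h0
    exact hx (hclr _ _ (SimpleGraph.Reachable.symm (hbij.mapsTo ht)) h0)
  let g' : ℕ → V := fun t => if t < 2 * N then g t else f (zigzagPlace a (t - 2 * N))
  have glow : ∀ t < 2 * N, g' t = g t := fun t ht => if_pos ht
  have ghigh : ∀ t, g' (2 * N + t) = f (zigzagPlace a t) := fun t => by simp [g']
  have split : ∀ t < 2 * (N + a), t < 2 * N ∨ ∃ u < 2 * a, t = 2 * N + u := by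
    intro t ht
    by_cases h : t < 2 * N
    · exact Or.inl h
    · exact Or.inr ⟨t - 2 * N, by omega, by omega⟩
  have hD'low : ∀ i ≤ N, (D (0 + i) ∨ 0 + i = N + a) ↔ D i := by
    intro i hi
    rw [zero_add]
    have : i ≠ N + a := by omega
    simp [this]
  have hD'high : ∀ i ≤ a, (D (N + i) ∨ N + i = N + a) ↔ (i = 0 ∨ i = a) := by
    intro i hi
    have : D (N + i) ↔ i = 0 :=
      ⟨fun h => by have := hDle _ h; omega, fun h => by rw [h]; exact hDN⟩
    rw [this]
    omega
  -- The break at `N` cuts both rails, so no zigzag edge joins the new block to the old ones.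
  have cross : ∀ t u, t < 2 * N → ¬ Zigzag (fun i => D i ∨ i = N + a) t (2 * N + u) := by
    rintro t u ht (h | h)
    · rcases h with ⟨h1, h2, h3⟩ | ⟨h1, h2, h3⟩ | ⟨h1, h2, -⟩
      · apply h3
        left
        rwa [show t / 2 + 1 = N by omega]
      · apply h3
        left
        rwa [show (t + 1) / 2 = N by omega]
      · omega
    · rcases h with ⟨-, h2, -⟩ | ⟨-, h2, -⟩ | ⟨-, h2, -⟩ <;> omega
  have crossH : ∀ t u, t < 2 * N → u < 2 * a → ¬ H.Adj (g t) (f (zigzagPlace a u)) := fun t u ht hu h =>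
    hout _ (zigzagPlace_lt hu) (hcl _ _ ⟨t, ht, rfl⟩ h)
  refine ih (k - 2 * a) (by omega) (N + a) (fun i => D i ∨ i = N + a) g' ?_ ?_ (Or.inl hD0)
    (Or.inr rfl) ?_ ?_ ?_ ?_
  · intro s hs t ht hst
    rcases split s hs with hs | ⟨s, hs', rfl⟩ <;> rcases split t ht with ht | ⟨t, ht', rfl⟩
    · rw [glow s hs, glow t ht] at hst
      exact hinj hs ht hst
    · rw [glow s hs, ghigh] at hst
      exact absurd ⟨s, hs, hst⟩ (hout _ (zigzagPlace_lt ht'))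
    · rw [glow t ht, ghigh] at hst
      exact absurd ⟨t, ht, hst.symm⟩ (hout _ (zigzagPlace_lt hs'))
    · rw [ghigh, ghigh] at hst
      rw [zigzagPlace_inj hs' ht' (hbij.injOn (zigzagPlace_lt hs') (zigzagPlace_lt ht') hst)]
  · have surj : ∀ z, H.Reachable x z → z ∈ g' '' Set.Iio (2 * (N + a)) := by
      intro z hz
      obtain ⟨t, ht, rfl⟩ := hbij.surjOn hz
      obtain ⟨u, hu, rfl⟩ := surjOn_zigzagPlace a ht
      exact ⟨2 * N + u, by simp only [Set.mem_Iio] at hu ⊢; omega, ghigh u⟩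
    rintro y z ⟨t, ht, rfl⟩ hyz
    rcases split t ht with ht | ⟨t, ht', rfl⟩
    · rw [glow t ht] at hyz
      obtain ⟨u, hu, rfl⟩ := hcl _ _ ⟨t, ht, rfl⟩ hyz
      exact ⟨u, by simp only [Set.mem_Iio] at hu ⊢; omega, glow u hu⟩
    · rw [ghigh] at hyz
      exact surj z (SimpleGraph.Reachable.trans (hbij.mapsTo (zigzagPlace_lt ht')) hyz.reachable)
  · rintro i (h | h)
    · have := hDle i h
      omega
    · omega
  · rintro i (h | h) (h' | h')
    · exact hDc i h h'
    · have := hDle i h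
      omega
    · have := hDle _ h'
      omega
    · omega
  · intro s hs t ht
    rcases split s hs with hs | ⟨s, hs', rfl⟩ <;> rcases split t ht with ht | ⟨t, ht', rfl⟩
    · rw [glow s hs, glow t ht, hadj s hs t ht]
      simpa using (zigzag_shift (D' := fun i => D i ∨ i = N + a) hD'low hs ht).symm
    · rw [glow s hs, ghigh]
      exact iff_of_false (crossH s t hs ht') (cross s t hs)
    · rw [glow t ht, ghigh]
      exact iff_of_false (fun h => crossH t s ht hs' h.symm) (fun h => cross t s ht h.symm)
    · rw [ghigh, ghigh, hfadj _ (zigzagPlace_lt hs') _ (zigzagPlace_lt ht'),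
        cycleAdj_zigzagPlace (by omega) hs' ht']
      exact (zigzag_shift (D' := fun i => D i ∨ i = N + a) hD'high hs' ht').symm
  · have h1 : (f '' Set.Iio (2 * a)).ncard = 2 * a := by
      rw [hbij.injOn.ncard_image, Set.ncard_eq_toFinset_card']
      simp
    have h2 : Disjoint (g '' Set.Iio (2 * N)) (f '' Set.Iio (2 * a)) := by
      rw [Set.disjoint_left]
      rintro _ h ⟨t, ht, rfl⟩
      exact hout t ht h
    have h3 := Set.ncard_union_eq h2 (Set.toFinite _) (Set.toFinite _)
    have h4 := Set.ncard_le_ncard (Set.subset_univ (g '' Set.Iio (2 * N) ∪ f '' Set.Iio (2 * a)))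
      (Set.toFinite _)
    rw [Set.ncard_univ] at h4
    omega

/-- A bipartite 2-factor is a zigzag graph. -/
theorem exists_zigzag {V : Type*} [Finite V] [Nonempty V] {H : SimpleGraph V} (hf : IsFactor 2 H)
    (hb : H.IsBipartite) : ∃ (N : ℕ) (D : ℕ → Prop) (g : ℕ → V), Nat.card V = 2 * N ∧
      Set.InjOn g (Set.Iio (2 * N)) ∧ D 0 ∧ D N ∧ (∀ i, D i → ¬ D (i + 1)) ∧
      ∀ x < 2 * N, ∀ y < 2 * N, H.Adj (g x) (g y) ↔ Zigzag D x y := by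
  -- Start with no vertex placed and the single break point 0; the values of `g` do not matter yet.
  refine exists_zigzag_extension hf hb (Nat.card V) 0 (fun i => i = 0)
    (fun _ => Classical.arbitrary V) ?_ ?_ rfl rfl ?_ ?_ ?_ ?_ <;> simp

/-! ### Splitting a doubled cycle into two copies of a 2-factor. -/

/-- The successor of `i` in the cycle `0, 1, …, N - 1`. -/
def cycleNext (N i : ℕ) : ℕ := if i + 1 = N then 0 else i + 1

/-- The predecessor of `i` in the cycle `0, 1, …, N - 1`. -/
def cyclePrev (N i : ℕ) : ℕ := if i = 0 then N - 1 else i - 1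

theorem cycleAdj_iff_next {N i j : ℕ} (hi : i < N) (hj : j < N) :
    CycleAdj N i j ↔ cycleNext N i = j ∨ cycleNext N j = i := by
  unfold CycleAdj cycleNext
  split_ifs <;> omega

/-- The number in the zigzag graph of the copy `ε` of the vertex `i` of a cycle. -/
def zigzagNumber (N : ℕ) (p : Fin N × Bool) : ℕ :=
  if p.2 then 2 * p.1 else 2 * cyclePrev N p.1 + 1

theorem zigzagNumber_lt {N : ℕ} (p : Fin N × Bool) : zigzagNumber N p < 2 * N := by
  have := p.1.2
  unfold zigzagNumber cyclePrev
  split_ifs <;> omega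

theorem zigzagNumber_injective (N : ℕ) : Function.Injective (zigzagNumber N) := by
  rintro ⟨⟨i, hi⟩, ε⟩ ⟨⟨j, hj⟩, δ⟩ h
  have key : i = j ∧ ε = δ := by
    cases ε <;> cases δ <;> simp only [zigzagNumber, cyclePrev] at h <;> split_ifs at h <;>
      simp_all <;> omega
  simp [key]

/-- The edges of the zigzag graph from copies of a vertex `i` of a cycle to copies of its
successor. -/
def ZigzagLink (D : ℕ → Prop) (i : ℕ) (ε δ : Bool) : Prop :=
  (ε = true ∧ δ = true ∧ ¬ D (i + 1)) ∨ (ε = true ∧ δ = false ∧ (D i ∨ D (i + 1))) ∨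
    (ε = false ∧ δ = false ∧ ¬ D i)

/-- Numbering shifts the odd rail by one column, so that rungs, like rails, run from copies of `i`
to copies of its successor: the zigzag graph lies inside the doubled cycle. The breaks at `0` and
`N` make the two sides agree at the wrap-around. -/
theorem zigzagLt_number {N : ℕ} {D : ℕ → Prop} (h0 : D 0) (hN : D N) (p q : Fin N × Bool) :
    ZigzagLt D (zigzagNumber N p) (zigzagNumber N q) ↔
      cycleNext N p.1 = q.1 ∧ ZigzagLink D p.1 p.2 q.2 := by
  obtain ⟨⟨i, hi⟩, ε⟩ := p
  obtain ⟨⟨j, hj⟩, δ⟩ := q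
  cases ε <;> cases δ
  · simp only [zigzagNumber, ZigzagLink, Bool.false_eq_true, if_false, zigzagLt_odd_odd, false_and,
      false_or, true_and]
    by_cases hi0 : i = 0
    · have e : cyclePrev N i + 1 = N := by rw [cyclePrev, if_pos hi0]; omega
      rw [e]
      simp [hi0, h0, hN]
    · have e : cyclePrev N i + 1 = i := by rw [cyclePrev, if_neg hi0]; omega
      rw [e]
      refine and_congr_left fun _ => ?_
      unfold cyclePrev cycleNext
      split_ifs <;> omega
  · simp [zigzagNumber, ZigzagLink, not_zigzagLt_odd_even]
  · simp only [zigzagNumber, ZigzagLink, Bool.false_eq_true, if_false, if_true, zigzagLt_even_odd,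
      false_and, true_and, and_false, or_false, false_or, Bool.true_eq_false]
    refine and_congr_left fun _ => ?_
    unfold cyclePrev cycleNext
    split_ifs <;> omega
  · simp only [zigzagNumber, ZigzagLink, if_true, zigzagLt_even_even,
      false_and, true_and, and_false, or_false, Bool.true_eq_false]
    refine and_congr_left fun h => ?_
    have : i + 1 ≠ N := fun h' => h (h' ▸ hN)
    rw [cycleNext, if_neg this]
    omega

theorem zigzag_number {N : ℕ} {D : ℕ → Prop} (h0 : D 0) (hN : D N) (p q : Fin N × Bool) :
    Zigzag D (zigzagNumber N p) (zigzagNumber N q) ↔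
      (cycleNext N p.1 = q.1 ∧ ZigzagLink D p.1 p.2 q.2) ∨
        (cycleNext N q.1 = p.1 ∧ ZigzagLink D q.1 q.2 p.2) :=
  or_congr (zigzagLt_number h0 hN p q) (zigzagLt_number h0 hN q p)

open Classical in
/-- Whether the two copies of the vertex `i` are exchanged to get the complementary zigzag graph. -/
noncomputable def zigzagFlip (D : ℕ → Prop) (i : ℕ) : Bool := decide (D i ∨ i % 2 = 1)

/-- Two of the four edges between the copies of `i` and of `i + 1` are links. If `D i` holds, both
start at the `true` copy of `i`, and exchanging the copies of `i` gives the other two. If `D (i +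
1)` holds, both end at the `false` copy of `i + 1`, and exchanging those copies does it. With no
break, the links form a parallel pair, and exactly one end must be exchanged; the parity rule
ensures this. At the wrap-around `0` and `N` are both breaks, so the parity of `N` is irrelevant. -/
theorem zigzagLink_flip {N : ℕ} {D : ℕ → Prop} (h0 : D 0) (hN : D N)
    (hD : ∀ i, D i → ¬ D (i + 1)) (i : ℕ) (ε δ : Bool) :
    ZigzagLink D i (xor ε (zigzagFlip D i)) (xor δ (zigzagFlip D (cycleNext N i))) ↔
      ¬ ZigzagLink D i ε δ := by
  have e : zigzagFlip D (cycleNext N i) = zigzagFlip D (i + 1) := by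
    unfold cycleNext
    split_ifs with h
    · simp [zigzagFlip, h, h0, hN]
    · rfl
  rw [e]
  have hDi := hD i
  have flip_true : ∀ j, D j → zigzagFlip D j = true := fun j hj => by simp [zigzagFlip, hj]
  have flip_odd : ∀ j, ¬ D j → zigzagFlip D j = decide (j % 2 = 1) := fun j hj => by
    simp [zigzagFlip, hj]
  have hp : decide ((i + 1) % 2 = 1) = !decide (i % 2 = 1) := by
    rw [← decide_not]
    congr 1
    exact propext (by omega)
  unfold ZigzagLink
  by_cases h1 : D i
  · rw [flip_true i h1, flip_odd (i + 1) (hDi h1)]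
    simp only [h1, hDi h1]
    cases ε <;> simp
    tauto
  · by_cases h2 : D (i + 1)
    · rw [flip_odd i h1, flip_true (i + 1) h2]
      simp only [h1, h2]
      cases δ <;> simp
      tauto
    · rw [flip_odd i h1, flip_odd (i + 1) h2, hp]
      simp only [h1, h2]
      cases ε <;> cases δ <;> simp <;> omega

/-- The graph obtained from a cycle by doubling its vertices decomposes into two copies of any
bipartite 2-factor. -/
theorem exists_two_copies {N : ℕ} (hN3 : 3 ≤ N) {Z : Type*} [Finite Z] {H : SimpleGraph Z}
    (hf : IsFactor 2 H) (hb : H.IsBipartite) (hcard : Nat.card Z = 2 * N) :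
    ∃ β₁ β₂ : Fin N × Bool ≃ Z, ∀ p q : Fin N × Bool,
      ((H.Adj (β₁ p) (β₁ q) ∨ H.Adj (β₂ p) (β₂ q)) ↔ CycleAdj N p.1 q.1) ∧
      ¬ (H.Adj (β₁ p) (β₁ q) ∧ H.Adj (β₂ p) (β₂ q)) := by
  have : Nonempty Z := (Nat.card_pos_iff.1 (by omega)).1
  obtain ⟨N', D, g, hc, hinj, h0, hN, hD, hadj⟩ := exists_zigzag hf hb
  obtain rfl : N' = N := by omega
  have hbij : Function.Bijective fun p => g (zigzagNumber N' p) := by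
    apply Function.Injective.bijective_of_nat_card_le
    · intro p q h
      exact zigzagNumber_injective N' (hinj (zigzagNumber_lt p) (zigzagNumber_lt q) h)
    · rw [hcard, Nat.card_prod, Nat.card_fin, Nat.card_eq_fintype_card, Fintype.card_bool]
      omega
  let β : Fin N' × Bool ≃ Z := Equiv.ofBijective _ hbij
  let flip : Fin N' × Bool ≃ Fin N' × Bool :=
    Function.Involutive.toPerm (fun p => (p.1, xor p.2 (zigzagFlip D p.1))) (by
      rintro ⟨i, ε⟩
      simp)
  have hβ : ∀ p q, H.Adj (β p) (β q) ↔
      (cycleNext N' p.1 = q.1 ∧ ZigzagLink D p.1 p.2 q.2) ∨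
        (cycleNext N' q.1 = p.1 ∧ ZigzagLink D q.1 q.2 p.2) := by
    intro p q
    rw [← zigzag_number h0 hN, ← hadj _ (zigzagNumber_lt p) _ (zigzagNumber_lt q)]
    rfl
  have hlink : ∀ p q : Fin N' × Bool, cycleNext N' p.1 = q.1 →
      (ZigzagLink D p.1 (flip p).2 (flip q).2 ↔ ¬ ZigzagLink D p.1 p.2 q.2) := by
    intro p q hpq
    have := zigzagLink_flip h0 hN hD p.1 p.2 q.2
    rw [hpq] at this
    exact this
  refine ⟨β, flip.trans β, fun p q => ?_⟩
  have e := hβ (flip p) (flip q)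
  have ep : (flip p).1 = p.1 := rfl
  have eq : (flip q).1 = q.1 := rfl
  rw [ep, eq] at e
  rw [Equiv.trans_apply, Equiv.trans_apply, e, hβ, cycleAdj_iff_next p.1.2 q.1.2]
  -- As `N' ≥ 3`, an edge of the cycle runs forward in only one direction, so just one of the two
  -- link conditions applies.
  have hnot : ¬ (cycleNext N' p.1 = q.1 ∧ cycleNext N' q.1 = p.1) := by
    have := p.1.2
    have := q.1.2
    unfold cycleNext
    split_ifs <;> omega
  have l1 := hlink p q
  have l2 := hlink q p
  by_cases h1 : cycleNext N' p.1 = q.1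
  · have h2 : ¬ cycleNext N' q.1 = p.1 := fun h => hnot ⟨h1, h⟩
    simp only [eq_true h1, eq_false h2, true_and, false_and, or_false, l1 h1, em, not_and_not_right,
      imp_self, and_self]
  · by_cases h2 : cycleNext N' q.1 = p.1
    · simp only [eq_false h1, eq_true h2, true_and, false_and, false_or, l2 h2, em,
        not_and_not_right, imp_self, and_self]
    · simp only [eq_false h1, eq_false h2, false_and, or_false, not_false_eq_true, and_self]

/-- A connected 2-regular graph on the set `S`, with its vertices doubled, decomposes into two
copies of any bipartite 2-factor. -/
theorem exists_double_decomposition {Y W Z : Type*} [Finite W] [Finite Z] (e : Y ≃ W × Bool)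
    (G : SimpleGraph W) (S : Set W) (hS : S.Nonempty) (hdeg : ∀ x ∈ S, (G.neighborSet x).ncard = 2)
    (hsupp : ∀ x y, G.Adj x y → x ∈ S) (hconn : ∀ x ∈ S, ∀ y ∈ S, G.Reachable x y)
    {H : SimpleGraph Z} (hf : IsFactor 2 H) (hb : H.IsBipartite) (hcard : Nat.card Z = 2 * S.ncard) :
    ∃ A B : SimpleGraph Y, Disjoint A B ∧ A ⊔ B = G.comap (fun y => (e y).1) ∧
      Nonempty (A.induce {y | (e y).1 ∈ S} ≃g H) ∧ Nonempty (B.induce {y | (e y).1 ∈ S} ≃g H) := by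
  obtain ⟨x, hx⟩ := hS
  have hcyc : G.IsCycles := by
    rintro v ⟨w, hw⟩
    exact hdeg v (hsupp v w hw)
  obtain ⟨N, f, hN3, -, hbij, hadj⟩ := exists_cycle_enumeration hcyc x
    (Set.nonempty_of_ncard_ne_zero (by rw [hdeg x hx]; omega))
  have hreach : {y | G.Reachable x y} = S := by
    ext y
    refine ⟨?_, fun hy => hconn x hx y hy⟩
    rintro ⟨p⟩
    cases p.reverse with
    | nil => exact hx
    | cons h _ => exact hsupp _ _ h
  rw [hreach] at hbij
  have hSN : S.ncard = N := by
    rw [← hbij.image_eq, hbij.injOn.ncard_image, Set.ncard_eq_toFinset_card']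
    simp
  obtain ⟨β₁, β₂, hβ⟩ := exists_two_copies hN3 hf hb (by rw [hcard, hSN])
  let γ : Fin N × Bool ↪ Y := ⟨fun p => e.symm (f p.1, p.2), by
    rintro ⟨i, ε⟩ ⟨j, δ⟩ h
    have h' := Prod.ext_iff.1 (e.symm.injective h)
    exact Prod.ext (Fin.ext (hbij.injOn i.2 j.2 h'.1)) h'.2⟩
  have hγ : ∀ p, (e (γ p)).1 = f p.1 := fun p => by
    change (e (e.symm (f p.1, p.2))).1 = _
    simp
  have hsurj : ∀ y, (e y).1 ∈ S → ∃ p, γ p = y := by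
    intro y hy
    obtain ⟨i, hi, hiy⟩ := hbij.surjOn hy
    refine ⟨(⟨i, hi⟩, (e y).2), ?_⟩
    apply e.injective
    change e (e.symm (f i, (e y).2)) = e y
    simp [hiy]
  let σ : Fin N × Bool ≃ {y | (e y).1 ∈ S} :=
    Equiv.ofBijective (fun p => ⟨γ p, by
      rw [Set.mem_ofPred_eq, hγ]
      exact hbij.mapsTo p.1.2⟩) ⟨fun p q h => γ.injective (Subtype.ext_iff.1 h), by
        rintro ⟨y, hy⟩
        obtain ⟨p, hp⟩ := hsurj y hy
        exact ⟨p, Subtype.ext hp⟩⟩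
  have iso : ∀ β : Fin N × Bool ≃ Z,
      Nonempty (((H.comap β).map γ).induce {y | (e y).1 ∈ S} ≃g H) := by
    intro β
    let τ : H.comap β ≃g ((H.comap β).map γ).induce {y | (e y).1 ∈ S} :=
      ⟨σ, SimpleGraph.map_adj_apply⟩
    exact ⟨τ.symm.trans (SimpleGraph.Iso.comap β H)⟩
  refine ⟨(H.comap β₁).map γ, (H.comap β₂).map γ, ?_, ?_, iso β₁, iso β₂⟩
  · rw [SimpleGraph.disjoint_left]
    intro y z hyz hyz'
    obtain ⟨p, q, hpq, rfl, rfl⟩ := (SimpleGraph.map_adj _ _ _ _).1 hyz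
    rw [SimpleGraph.map_adj_apply] at hyz'
    exact (hβ p q).2 ⟨hpq, hyz'⟩
  · have key : ∀ p q, ((H.comap β₁).map γ ⊔ (H.comap β₂).map γ).Adj (γ p) (γ q) ↔
        (G.comap (fun y => (e y).1)).Adj (γ p) (γ q) := by
      intro p q
      rw [SimpleGraph.sup_adj, SimpleGraph.map_adj_apply, SimpleGraph.map_adj_apply,
        SimpleGraph.comap_adj (G := G), hγ, hγ, hadj _ p.1.2 _ q.1.2]
      exact (hβ p q).1
    ext y z
    constructor
    · intro h
      obtain ⟨p, q, rfl, rfl⟩ : ∃ p q, y = γ p ∧ z = γ q := by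
        rcases h with h | h <;> obtain ⟨p, q, -, rfl, rfl⟩ := (SimpleGraph.map_adj _ _ _ _).1 h <;>
          exact ⟨p, q, rfl, rfl⟩
      exact (key p q).1 h
    · intro h
      obtain ⟨p, rfl⟩ := hsurj y (hsupp _ _ h)
      obtain ⟨q, rfl⟩ := hsurj z (hsupp _ _ h.symm)
      exact (key p q).2 h

/-! ### Amalgams with all weights one, and the two-vertex amalgam. -/

namespace IsAmalgam

variable {C W : Type*} [Fintype C] [Fintype W] {μ : C → W → W → ℕ} {act : C → W → Prop}

theorem multiplicity_self (h : IsAmalgam (fun _ => 1) μ act) (c : C) (x : W) : μ c x x = 0 :=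
  (by simpa using h.sum_diag x : ∀ c, μ c x x = 0) c

theorem multiplicity_le_one (h : IsAmalgam (fun _ => 1) μ act) (c : C) (x y : W) : μ c x y ≤ 1 := by
  by_cases hxy : x = y
  · rw [hxy, h.multiplicity_self]
    omega
  · have := h.sum_off x y hxy
    rw [← Nat.mul_one 1, ← this]
    exact Finset.single_le_sum (f := fun c => μ c x y) (fun _ _ => Nat.zero_le _) (Finset.mem_univ c)

theorem exists_adj (h : IsAmalgam (fun _ => 1) μ act) {x y : W} (hxy : x ≠ y) :
    ∃ c, (multiplicityGraph (μ c)).Adj x y := by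
  by_contra h0
  push Not at h0
  have := h.sum_off x y hxy
  rw [Finset.sum_eq_zero] at this
  · omega
  · intro c _
    have := h0 c
    rw [h.adj_iff] at this
    tauto

theorem colour_unique (h : IsAmalgam (fun _ => 1) μ act) {x y : W} {c d : C}
    (hc : (multiplicityGraph (μ c)).Adj x y) (hd : (multiplicityGraph (μ d)).Adj x y) : c = d := by
  classical
  rw [h.adj_iff] at hc hd
  by_contra hcd
  have h1 := h.sum_off x y hc.1
  have h2 : ∑ a ∈ {c, d}, μ a x y ≤ ∑ a, μ a x y := Finset.sum_le_sum_of_subset (Finset.subset_univ _)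
  rw [Finset.sum_pair hcd] at h2
  omega

theorem ncard_neighborSet (h : IsAmalgam (fun _ => 1) μ act) {c : C} {x : W} (hx : act c x) :
    ((multiplicityGraph (μ c)).neighborSet x).ncard = 2 := by
  classical
  have h1 := h.deg_act c x hx
  have h2 : (multiplicityGraph (μ c)).neighborSet x
      = ((Finset.univ.filter fun y => μ c x y ≠ 0 : Finset W) : Set W) := by
    ext y
    simp only [SimpleGraph.mem_neighborSet, h.adj_iff, Finset.coe_filter, Finset.mem_univ, true_and,
      Set.mem_ofPred_eq, and_iff_right_iff_imp]
    rintro h0 rfl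
    exact h0 (h.multiplicity_self c x)
  rw [h2, Set.ncard_coe_finset, Finset.card_filter, ← mul_one 2, ← h1]
  refine Finset.sum_congr rfl fun y _ => ?_
  have := h.multiplicity_le_one c x y
  split_ifs <;> omega

theorem act_of_adj (h : IsAmalgam (fun _ => 1) μ act) {c : C} {x y : W}
    (hxy : (multiplicityGraph (μ c)).Adj x y) : act c x := by
  by_contra hx
  have := Finset.sum_eq_zero_iff.1 (h.deg_not_act c x hx) y (Finset.mem_univ y)
  exact ((h.adj_iff c x y).1 hxy).2 this

end IsAmalgam

/-- The groups of vertices of the parts `true` and `false` covered by the colours. -/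
def partAct {k h : ℕ} : Fin k ⊕ Fin k ⊕ Fin h → Bool → Prop
  | .inl _, x => x = true
  | .inr (.inl _), x => x = false
  | .inr (.inr _), _ => True

/-- Edge multiplicities after a complete graph with parts of sizes `n` and `w` is merged into two
vertices, in `k` colours inside each part and `h` colours on the whole. -/
def partMult (n w : ℕ) {k h : ℕ} : Fin k ⊕ Fin k ⊕ Fin h → Bool → Bool → ℕ
  | .inl _, true, true => 2 * n
  | .inl _, _, _ => 0
  | .inr (.inl _), false, false => 2 * w
  | .inr (.inl _), _, _ => 0
  | .inr (.inr _), true, true => 0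
  | .inr (.inr _), false, false => 2 * (w - n)
  | .inr (.inr _), _, _ => 2 * n

/-- A spanning Hamilton cycle is to have no edge inside the `n`-part, so it has `2n` cross edges and
`w - n ≥ 0` edges in the `w`-part. The totals fit: `2nk = n(n-1)` inside the first part, `2nh = nw`
across, and `2wk + 2h(w-n) = w(w-1)` inside the second. -/
theorem isAmalgam_part {n w k h : ℕ} (hn : n = 2 * k + 1) (hw : w = 2 * h) (hnw : n ≤ w) :
    IsAmalgam (fun x : Bool => if x then n else w) (partMult n w (k := k) (h := h)) partAct where
  pos x := by cases x <;> simp <;> omega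
  symm c x y := by rcases c with c | c | c <;> cases x <;> cases y <;> rfl
  even_diag c x := by rcases c with c | c | c <;> cases x <;> simp [partMult]
  sum_off x y hxy := by
    cases x <;> cases y
    · exact absurd rfl hxy
    · simp [partMult, hw]
      ring
    · simp [partMult, hw]
      ring
    · exact absurd rfl hxy
  sum_diag x := by
    cases x
    · obtain ⟨d, rfl⟩ := Nat.exists_eq_add_of_le hnw
      simp only [partMult, Fintype.sum_sum_type, Finset.sum_const, Finset.card_univ, Fintype.card_fin,
        smul_eq_mul, Bool.false_eq_true, if_false, Nat.add_sub_cancel_left]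
      have e1 : n + d - 1 = 2 * k + d := by omega
      have e2 : h * (2 * d) = (n + d) * d := by rw [hw]; ring
      rw [e1, e2]
      ring
    · simp only [partMult, Fintype.sum_sum_type, Finset.sum_const, Finset.card_univ, Fintype.card_fin,
        smul_eq_mul, if_true, hn, Nat.add_sub_cancel]
      ring
  deg_act c x hx := by
    rcases c with c | c | c <;> cases x <;> simp [partMult, partAct] at hx ⊢
    omega
  deg_not_act c x hx := by
    rcases c with c | c | c <;> cases x <;> simp [partMult, partAct] at hx ⊢
  conn c x y hx hy := by
    have hn0 : n ≠ 0 := by omega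
    rcases c with c | c | c
    · have hxt : x = true := hx
      have hyt : y = true := hy
      rw [hxt, hyt]
    · have hxt : x = false := hx
      have hyt : y = false := hy
      rw [hxt, hyt]
    · by_cases hxy : x = y
      · rw [hxy]
      · refine SimpleGraph.Adj.reachable ?_
        cases x <;> cases y <;> simp_all [multiplicityGraph, partMult]

/-! ### Pairs of prescribed factors on the doubled vertex set. -/

/-- Connected 2-regular graphs on the set `S`, with their vertices doubled, decompose into prescribed
bipartite 2-factors coming in pairs. -/
theorem exists_pair_family {Y W : Type*} {r : ℕ} [Finite W] (e : Y ≃ W × Bool) {k l : ℕ}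
    (hl : l = 2 * k) (G : Fin k → SimpleGraph W) (S : Set W) (hS : S.Nonempty)
    (hdeg : ∀ c, ∀ x ∈ S, ((G c).neighborSet x).ncard = 2) (hsupp : ∀ c x y, (G c).Adj x y → x ∈ S)
    (hconn : ∀ c, ∀ x ∈ S, ∀ y ∈ S, (G c).Reachable x y) (H : Fin l → SimpleGraph (Fin r))
    (hH : ∀ i, IsFactor 2 (H i) ∧ (H i).IsBipartite) (hH2 : EqualPairs H) (hr : r = 2 * S.ncard) :
    ∃ A : Fin l → SimpleGraph Y,
      (∀ i, Nonempty ((A i).induce {y | (e y).1 ∈ S} ≃g H i)) ∧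
      (∀ i y z, (A i).Adj y z → (G ⟨i / 2, by omega⟩).Adj (e y).1 (e z).1) ∧
      (∀ i j : Fin l, i ≠ j → i.1 / 2 = j.1 / 2 → Disjoint (A i) (A j)) ∧
      ∀ c y z, (G c).Adj (e y).1 (e z).1 → ∃ i, (A i).Adj y z := by
  have ex : ∀ c : Fin k, _ := fun c => exists_double_decomposition e (G c) S hS (hdeg c) (hsupp c)
    (hconn c) (hH ⟨2 * c, by omega⟩).1 (hH ⟨2 * c, by omega⟩).2 (by rw [Nat.card_fin, hr])
  choose A B hdis hsup hA hB using ex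
  have hadj : ∀ c y z, ((A c).Adj y z ∨ (B c).Adj y z) ↔ (G c).Adj (e y).1 (e z).1 := by
    intro c y z
    rw [← SimpleGraph.sup_adj, hsup]
    rfl
  -- Factors `2c` and `2c + 1` are the two halves of the doubled cycle `c`. Both halves are copies
  -- of `H (2c)`, and `EqualPairs` identifies the second with `H (2c + 1)`.
  refine ⟨fun i => if i.1 % 2 = 0 then A ⟨i / 2, by omega⟩ else B ⟨i / 2, by omega⟩, ?_, ?_, ?_, ?_⟩
  · intro i
    dsimp only
    split_ifs with hi
    · have hi2 : i = ⟨2 * (i.1 / 2), by omega⟩ := Fin.ext (by simp only; omega)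
      have := hA ⟨i / 2, by omega⟩
      rwa [← hi2] at this
    · obtain ⟨f⟩ := hB ⟨i / 2, by omega⟩
      obtain ⟨g⟩ := hH2 ⟨2 * (i.1 / 2), by omega⟩ i (even_two_mul _) (by simp only; omega)
      exact ⟨f.trans g⟩
  · intro i y z h
    dsimp only at h
    rw [← hadj]
    split_ifs at h
    · exact Or.inl h
    · exact Or.inr h
  · intro i j hij hd
    have hne : i.1 ≠ j.1 := fun h => hij (Fin.ext h)
    have hc : (⟨i.1 / 2, by omega⟩ : Fin k) = ⟨j.1 / 2, by omega⟩ := Fin.ext hd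
    dsimp only
    rw [hc]
    split_ifs
    · omega
    · exact hdis _
    · exact (hdis _).symm
    · omega
  · intro c y z h
    rcases (hadj c y z).2 h with h | h
    · refine ⟨⟨2 * c, by omega⟩, ?_⟩
      have e1 : (2 * c.1) % 2 = 0 := by omega
      have e2 : (⟨2 * c.1 / 2, by omega⟩ : Fin k) = c := Fin.ext (by simp)
      simp only [e1, if_true, e2]
      exact h
    · refine ⟨⟨2 * c + 1, by omega⟩, ?_⟩
      have e1 : ¬ (2 * c.1 + 1) % 2 = 0 := by omega
      have e2 : (⟨(2 * c.1 + 1) / 2, by omega⟩ : Fin k) = c := Fin.ext (by simp only; omega)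
      simp only [e1, if_false, e2]
      exact h

/-- A complete multipartite graph with parts of size two is a complete graph minus a 1-factor. -/
theorem isCompleteStar_comap {Y W : Type*} (q : Y → W) (τ : Y → Y)
    (hτ : ∀ x y, (x ≠ y ∧ q x = q y) ↔ y = τ x) (hY : Even (Nat.card Y)) :
    IsCompleteStar ((⊤ : SimpleGraph W).comap q) := by
  refine Or.inr ⟨hY, ⟨fun x y => x ≠ y ∧ q x = q y, ⟨fun x y h => ⟨h.1.symm, h.2.symm⟩⟩,
    ⟨fun x h => h.1 rfl⟩⟩, ?_, ?_⟩
  · intro x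
    have : SimpleGraph.neighborSet ⟨fun x y => x ≠ y ∧ q x = q y,
        ⟨fun x y h => ⟨h.1.symm, h.2.symm⟩⟩, ⟨fun x h => h.1 rfl⟩⟩ x = {τ x} := by
      ext y
      exact hτ x y
    rw [this, Set.ncard_singleton]
  · ext x y
    simp only [SimpleGraph.comap_adj, SimpleGraph.top_adj, SimpleGraph.sdiff_adj]
    constructor
    · intro h
      exact ⟨fun h0 => h (h0 ▸ rfl), fun h0 => h h0.2⟩
    · rintro ⟨h1, h2⟩ h3
      exact h2 ⟨h1, h3⟩

theorem IsFactor.of_iso {V V' : Type*} {r : ℕ} {G : SimpleGraph V} {G' : SimpleGraph V'}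
    (h : IsFactor r G') (f : G ≃g G') : IsFactor r G := by
  intro x
  rw [← h (f x)]
  exact Nat.card_congr (f.mapNeighborSet x)

/-! ### Necessity of `2 * m ≤ v`. -/

/-- The factors `F i` have no edges inside the subsystem, which is thus at most half of the
vertices. -/
theorem MSF.two_mul_le {v m f t : ℕ} {F : Fin f → SimpleGraph (Fin v)}
    {T : Fin t → SimpleGraph (Fin m)} {U : Fin t → SimpleGraph (Fin (v - m))} (X : MSF F T U)
    (hv : Even v) (hF : ∀ i, IsFactor 2 (F i)) (i : Fin f) : 2 * m ≤ v := by
  classical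
  obtain ⟨φ⟩ := X.iso_F i
  have hA : IsFactor 2 (X.A i) := (hF i).of_iso φ
  have hM : ∀ x ∈ X.M, ∀ y ∈ X.M, ¬ (X.A i).Adj x y := by
    intro x hx y hy hxy
    have hK : X.K.Adj x y := by
      rw [← X.factorization_K.2, SimpleGraph.iSup_adj]
      exact ⟨Sum.inl i, hxy⟩
    -- An edge inside `M` is either in `H`, hence already covered by some `B j`, or in the 1-factor
    -- missing from `H`, hence missing from `K`.
    by_cases hH : X.H.Adj ⟨x, hx⟩ ⟨y, hy⟩
    · rw [← X.factorization_H.2, SimpleGraph.iSup_adj] at hH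
      obtain ⟨j, hj⟩ := hH
      have := X.factorization_K.1 (show Sum.inl i ≠ Sum.inr j by simp)
      refine SimpleGraph.disjoint_left.1 this x y hxy (Or.inl ?_)
      exact (SimpleGraph.map_adj _ _ _ _).2 ⟨_, _, hj, rfl, rfl⟩
    · have : X.Hᶜ.spanningCoe.Adj x y := (SimpleGraph.map_adj _ _ _ _).2
        ⟨⟨x, hx⟩, ⟨y, hy⟩, ⟨fun h => hxy.ne (Subtype.ext_iff.1 h), hH⟩, rfl, rfl⟩
      exact (X.leave_le hv this).2 hK
  have hMc : X.M.toFinset.card = m := by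
    rw [← Set.ncard_eq_toFinset_card', X.ncard_M]
  -- Count the edges of `A i` between `M` and its complement from both sides.
  have key := Finset.card_mul_le_card_mul (s := X.M.toFinset) (t := X.M.toFinsetᶜ) (m := 2) (n := 2)
    (fun x y => (X.A i).Adj x y) (by
      intro x hx
      rw [← hA x, ← Set.ncard_coe_finset]
      refine Set.ncard_le_ncard ?_ (Set.toFinite _)
      intro y hy
      have hyM : y ∉ X.M := fun hyM => hM x (by simpa using hx) y hyM hy
      simpa [Finset.bipartiteAbove, hyM] using hy) (by
      intro y _
      rw [← hA y, ← Set.ncard_coe_finset]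
      refine Set.ncard_le_ncard ?_ (Set.toFinite _)
      intro x hx
      simp only [Finset.bipartiteBelow, Finset.coe_filter, Set.mem_ofPred_eq] at hx
      exact hx.2.symm)
  rw [Finset.card_compl, hMc, Fintype.card_fin] at key
  omega

/-! ### Sufficiency: the Hamilton decomposition and its doubling. -/

/-- A decomposition of a complete graph on `2k + 1 + w` vertices into Hamilton cycles of the first
`2k + 1` vertices, Hamilton cycles of the last `w` vertices, and Hamilton cycles of the whole. -/
theorem exists_hamilton_decomposition {n w k h : ℕ} (hn : n = 2 * k + 1) (hw : w = 2 * h)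
    (hnw : n ≤ w) :
    ∃ (W : Type) (_ : Fintype W) (π : W → Bool) (G : Fin k ⊕ Fin k ⊕ Fin h → SimpleGraph W),
      {x | π x = true}.ncard = n ∧ {x | π x = false}.ncard = w ∧
      (∀ x y, x ≠ y → ∃ c, (G c).Adj x y) ∧
      (∀ x y c d, (G c).Adj x y → (G d).Adj x y → c = d) ∧
      (∀ c x, partAct c (π x) → ((G c).neighborSet x).ncard = 2) ∧
      (∀ c x y, (G c).Adj x y → partAct c (π x)) ∧
      (∀ c x y, partAct c (π x) → partAct c (π y) → (G c).Reachable x y) ∧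
      ∀ c x y, (G c).Adj x y → π x = true → π y = true → ∃ j, c = Sum.inl j := by
  obtain ⟨W, hW, π, μ, hμ, hne, hcard⟩ := exists_detachment _ _ _ (isAmalgam_part hn hw hnw)
  refine ⟨W, hW, π, fun c => multiplicityGraph (μ c), by simpa using hcard true,
    by simpa using hcard false, fun x y hxy => hμ.exists_adj hxy, fun x y c d => hμ.colour_unique,
    fun c x hx => hμ.ncard_neighborSet hx, fun c x y => hμ.act_of_adj, hμ.conn, ?_⟩
  intro c x y hxy hx hy
  have h0 := hne c x y ((hμ.adj_iff c x y).1 hxy).2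
  rw [hx, hy] at h0
  rcases c with c | c | c
  · exact ⟨c, rfl⟩
  · exact absurd rfl h0
  · exact absurd rfl h0

theorem nonempty_MSF {v m : ℕ} (hmv : m < v) (hv : v % 4 = 2) (hm : m % 4 = 2)
    (F : Fin ((v - m) / 2) → SimpleGraph (Fin v))
    (T : Fin ((m - 2) / 2) → SimpleGraph (Fin m))
    (U : Fin ((m - 2) / 2) → SimpleGraph (Fin (v - m)))
    (hF : ∀ i, IsFactor 2 (F i) ∧ (F i).IsBipartite)
    (hT : ∀ j, IsFactor 2 (T j) ∧ (T j).IsBipartite)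
    (hU : ∀ j, IsFactor 2 (U j) ∧ (U j).IsBipartite)
    (hF2 : EqualPairs F) (hT2 : EqualPairs T) (hU2 : EqualPairs U) (h : 2 * m ≤ v) :
    Nonempty (MSF F T U) := by
  classical
  -- Here `n = m / 2 = 2 * k + 1` and `w = (v - m) / 2 = 2 * h'`; the bound `2 * m ≤ v` becomes `n ≤
  -- w`.
  obtain ⟨k, h', rfl, hvw⟩ : ∃ k h', m = 2 * (2 * k + 1) ∧ v = 2 * (2 * k + 1) + 2 * (2 * h') :=
    ⟨m / 4, (v - m) / 4, by omega, by omega⟩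
  obtain ⟨W, _, π, G, hn, hw, hex, huniq, hdeg, hact, hconn, hM⟩ :=
    exists_hamilton_decomposition (n := 2 * k + 1) (w := 2 * h') (k := k) (h := h') rfl rfl
      (by omega)
  have huniv : (Set.univ : Set W).ncard = 2 * k + 1 + 2 * h' := by
    rw [← hn, ← hw, ← Set.ncard_union_eq]
    · congr 1
      ext x
      cases hx : π x <;> simp [hx]
    · rw [Set.disjoint_left]
      intro x h1 h2
      rw [Set.mem_ofPred_eq] at h1 h2
      rw [h1] at h2
      exact absurd h2 (by simp)
  have hW : Nat.card (W × Bool) = v := by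
    rw [Nat.card_prod, ← Set.ncard_univ, huniv, Nat.card_eq_fintype_card, Fintype.card_bool]
    omega
  let e : Fin v ≃ W × Bool := Fintype.equivOfCardEq (by
    rw [← Nat.card_eq_fintype_card, ← Nat.card_eq_fintype_card, hW, Nat.card_fin])
  obtain ⟨AF, isoF, leF, disF, supF⟩ := exists_pair_family e (k := h') (by omega)
    (fun c => G (.inr (.inr c))) Set.univ (Set.nonempty_of_ncard_ne_zero (by omega))
    (fun c x _ => hdeg _ x trivial) (fun _ _ _ _ => trivial)
    (fun c x _ y _ => hconn _ x y trivial trivial) F hF hF2 (by omega)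
  obtain ⟨AT, isoT, leT, disT, supT⟩ := exists_pair_family e (k := k) (by omega)
    (fun c => G (.inl c)) {x | π x = true} (Set.nonempty_of_ncard_ne_zero (by omega))
    (fun c x hx => hdeg _ x hx) (fun c x y => hact _ x y)
    (fun c x hx y hy => hconn _ x y hx hy) T hT hT2 (by omega)
  obtain ⟨AU, isoU, leU, disU, supU⟩ := exists_pair_family e (k := k) (by omega)
    (fun c => G (.inr (.inl c))) {x | π x = false} (Set.nonempty_of_ncard_ne_zero (by omega))
    (fun c x hx => hdeg _ x hx) (fun c x y => hact _ x y)
    (fun c x hx y hy => hconn _ x y hx hy) U hU hU2 (by omega)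
  have hMc : {y | (e y).1 ∈ {x | π x = false}} = {y | (e y).1 ∈ {x | π x = true}}ᶜ := by
    ext y
    simp
  rw [hMc] at isoU
  set M : Set (Fin v) := {y | (e y).1 ∈ {x | π x = true}} with hMdef
  have memM : ∀ y, y ∈ M ↔ π (e y).1 = true := fun y => Iff.rfl
  have spanT : ∀ j, ((AT j).induce M).spanningCoe = AT j := fun j =>
    SimpleGraph.spanningCoe_induce_eq_self _ _ |>.2 (by
      rintro y ⟨z, hyz⟩
      exact hact _ _ _ (leT j y z hyz))
  have spanU : ∀ j, ((AU j).induce Mᶜ).spanningCoe = AU j := fun j =>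
    SimpleGraph.spanningCoe_induce_eq_self _ _ |>.2 (by
      rintro y ⟨z, hyz⟩ hy
      have h1 : π (e y).1 = false := hact _ _ _ (leU j y z hyz)
      rw [(memM y).1 hy] at h1
      exact absurd h1 (by simp))
  -- The missing 1-factor `I` pairs the two copies of each vertex; `M` is a union of such pairs, so
  -- its share `J` lies in `I`.
  let τ : Fin v → Fin v := fun y => e.symm ((e y).1, !(e y).2)
  have hτ : ∀ x y, (x ≠ y ∧ (e x).1 = (e y).1) ↔ y = τ x := by
    intro x y
    rw [Equiv.eq_symm_apply, Prod.ext_iff, ← e.injective.ne_iff, Ne, Prod.ext_iff]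
    cases (e x).2 <;> cases (e y).2 <;> simp [eq_comm]
  have hcardM : M.ncard = 2 * (2 * k + 1) := by
    have : M = e ⁻¹' ({x | π x = true} ×ˢ Set.univ) := by
      ext y
      simp [hMdef]
    rw [this, Set.ncard_preimage_of_injective_subset_range e.injective (by simp), Set.ncard_prod, hn,
      Set.ncard_univ, Nat.card_eq_fintype_card, Fintype.card_bool, mul_comm]
  have noAdj : ∀ y z c, (G c).Adj (e y).1 (e z).1 → (e y).1 ≠ (e z).1 := fun y z c h => h.ne
  refine ⟨{
    K := (⊤ : SimpleGraph W).comap fun y => (e y).1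
    isCompleteStar_K := isCompleteStar_comap _ τ hτ (by
      rw [Nat.card_fin]
      exact Nat.even_iff.2 (by omega))
    M := M
    ncard_M := hcardM
    H := (⊤ : SimpleGraph W).comap fun y : M => (e y).1
    isCompleteStar_H := isCompleteStar_comap _
      (fun y => ⟨τ y, by
        rw [memM]
        simp only [τ, Equiv.apply_symm_apply]
        exact y.2⟩) (by
        rintro ⟨x, hx⟩ ⟨y, hy⟩
        simpa using hτ x y) (by
        rw [Nat.card_coe_set_eq, hcardM]
        exact even_two_mul _)
    H_le_K := by
      intro x y hxy
      obtain ⟨a, b, hab, rfl, rfl⟩ := (SimpleGraph.map_adj _ _ _ _).1 hxy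
      exact hab
    leave_le := by
      intro _ x y hxy
      obtain ⟨a, b, hab, rfl, rfl⟩ := (SimpleGraph.map_adj _ _ _ _).1 hxy
      exact ⟨fun h0 => hab.1 (Subtype.ext h0), hab.2⟩
    A := AF
    B := fun j => (AT j).induce M
    C := fun j => (AU j).induce Mᶜ
    iso_F := ?_
    iso_T := isoT
    iso_U := isoU
    factorization_K := ?_
    factorization_H := ?_ }⟩
  · intro i
    have hS : {y | (e y).1 ∈ (Set.univ : Set W)} = Set.univ := by
      ext y
      simp
    obtain ⟨φ⟩ := isoF i
    rw [hS] at φ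
    exact ⟨(SimpleGraph.induceUnivIso (AF i)).symm.trans φ⟩
  · simp only [spanT, spanU]
    have disTT : ∀ i j, i ≠ j → ∀ y z, (AT i).Adj y z → ¬ (AT j).Adj y z := by
      intro i j hij y z h1 h2
      have hc := huniq _ _ _ _ (leT i y z h1) (leT j y z h2)
      have hc' : i.1 / 2 = j.1 / 2 := by simpa using hc
      exact SimpleGraph.disjoint_left.1 (disT i j hij hc') y z h1 h2
    have disUU : ∀ i j, i ≠ j → ∀ y z, (AU i).Adj y z → ¬ (AU j).Adj y z := by
      intro i j hij y z h1 h2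
      have hc := huniq _ _ _ _ (leU i y z h1) (leU j y z h2)
      have hc' : i.1 / 2 = j.1 / 2 := by simpa using hc
      exact SimpleGraph.disjoint_left.1 (disU i j hij hc') y z h1 h2
    have disTU : ∀ i j y z, (AT i).Adj y z → ¬ (AU j).Adj y z := by
      intro i j y z h1 h2
      simpa using huniq _ _ _ _ (leT i y z h1) (leU j y z h2)
    have disFTU : ∀ i j y z, (AF i).Adj y z → ¬ (AT j ⊔ AU j).Adj y z := by
      rintro i j y z h1 (h2 | h2)
      · simpa using huniq _ _ _ _ (leF i y z h1) (leT j y z h2)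
      · simpa using huniq _ _ _ _ (leF i y z h1) (leU j y z h2)
    constructor
    · rintro (i | i) (j | j) hij <;> rw [SimpleGraph.disjoint_left] <;> intro y z h1 h2
      · have hij' : i ≠ j := fun h0 => hij (by rw [h0])
        have hc := huniq _ _ _ _ (leF i y z h1) (leF j y z h2)
        have hc' : i.1 / 2 = j.1 / 2 := by simpa using hc
        exact SimpleGraph.disjoint_left.1 (disF i j hij' hc') y z h1 h2
      · exact disFTU i j y z h1 h2
      · exact disFTU j i y z h2 h1
      · have hij' : i ≠ j := fun h0 => hij (by rw [h0])
        rcases h1 with h1 | h1 <;> rcases h2 with h2 | h2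
        · exact disTT i j hij' y z h1 h2
        · exact disTU i j y z h1 h2
        · exact disTU j i y z h2 h1
        · exact disUU i j hij' y z h1 h2
    · ext y z
      rw [SimpleGraph.iSup_adj, SimpleGraph.comap_adj, SimpleGraph.top_adj]
      constructor
      · rintro ⟨i | j, hA⟩
        · exact noAdj y z _ (leF i y z hA)
        rcases hA with hA | hA
        · exact noAdj y z _ (leT j y z hA)
        · exact noAdj y z _ (leU j y z hA)
      · intro hyz
        obtain ⟨c | c | c, hc⟩ := hex _ _ hyz
        · obtain ⟨i, hi⟩ := supT c y z hc
          exact ⟨Sum.inr i, Or.inl hi⟩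
        · obtain ⟨i, hi⟩ := supU c y z hc
          exact ⟨Sum.inr i, Or.inr hi⟩
        · obtain ⟨i, hi⟩ := supF c y z hc
          exact ⟨Sum.inl i, hi⟩
  · constructor
    · intro i j hij
      rw [SimpleGraph.disjoint_left]
      intro y z h1 h2
      have hc := huniq _ _ _ _ (leT i y z h1) (leT j y z h2)
      have hc' : i.1 / 2 = j.1 / 2 := by simpa using hc
      exact SimpleGraph.disjoint_left.1 (disT i j hij hc') y z h1 h2
    · ext y z
      rw [SimpleGraph.iSup_adj, SimpleGraph.comap_adj, SimpleGraph.top_adj]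
      constructor
      · rintro ⟨j, hA⟩
        exact noAdj y z _ (leT j y z hA)
      · intro hyz
        obtain ⟨c, hc⟩ := hex _ _ hyz
        -- Only the first `k` colours have edges inside the `true` part, so the `T j` cover all of
        -- `H`.
        obtain ⟨j, rfl⟩ := hM c _ _ hc y.2 z.2
        exact supT j y z hc

end Minisymposium

theorem mainTheorem2 (v m : ℕ) (hmv : m < v) (hv : v % 4 = 2) (hm : m % 4 = 2)
    (F : Fin ((v - m) / 2) → SimpleGraph (Fin v))
    (T : Fin ((m - 2) / 2) → SimpleGraph (Fin m))
    (U : Fin ((m - 2) / 2) → SimpleGraph (Fin (v - m)))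
    (hF : ∀ i, Minisymposium.IsFactor 2 (F i) ∧ (F i).IsBipartite)
    (hT : ∀ j, Minisymposium.IsFactor 2 (T j) ∧ (T j).IsBipartite)
    (hU : ∀ j, Minisymposium.IsFactor 2 (U j) ∧ (U j).IsBipartite)
    (hF2 : Minisymposium.EqualPairs F)
    (hT2 : Minisymposium.EqualPairs T)
    (hU2 : Minisymposium.EqualPairs U) :
    Nonempty (Minisymposium.MSF F T U) ↔ 2 * m ≤ v := by
  constructor
  · rintro ⟨X⟩
    -- A factor `F 0` exists because `v - m` is a positive multiple of 4.
    exact X.two_mul_le (Nat.even_iff.2 (by omega)) (fun i => (hF i).1) ⟨0, by omega⟩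
  · exact Minisymposium.nonempty_MSF hmv hv hm F T U hF hT hU hF2 hT2 hU2
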